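/- Let $\mathbb F$ be $\mathbb R$ or $\mathbb C$, let $n\ge 2$, and let $\gamma=(\gamma_1,\dots,\gamma_n)\in\mathbb F^n$ be a tuple whose entries are not all equal. Let $\mathfrak t_\gamma(n)$ be the Lie algebra of $n\times n$ matrices with basis the matrix units $e_{ij}$, $i<j$ (a basis of its nilradical $\mathfrak t_0(n)$ of strictly upper triangular matrices) and $f=\mathrm{diag}(\gamma_1,\dots,\gamma_n)$, and let ${\rm T}_\gamma(n)$ be the Lie group of upper triangular matrices $B$ with $b_{ii}=e^{\gamma_i\varepsilon}$ for some $\varepsilon\in\mathbb F$, acting on $\mathfrak t_\gamma^*(n)$ by the coadjoint action $({\rm Ad}^*_B\xi)(Y)=\xi(B^{-1}YB)$. On $\mathfrak t_\gamma^*(n)$ use the coordinates $x_0(\xi)=\xi(f)$ and $x_{ji}(\xi)=\xi(e_{ij})$, $i<j$; let $X=(x_{ij})$ be the strictly lower triangular matrix of the coordinates $x_{ij}$, $j<i$, let $X^{i_1,i_2}_{j_1,j_2}$ be its submatrix with the rows $i_1,\dots,i_2$ and the columns $j_1,\dots,j_2$, let $|\cdot|$ denote the determinant, and put $\varkappa=n-k+1$,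 $\varkappa_0=n-k_0+1$. Smooth (over $\mathbb C$: holomorphic) invariants $F_1,\dots,F_m$ of ${\rm Ad}^*_{{\rm T}_\gamma(n)}$, each defined on an open set, are called a basis of ${\rm Inv}({\rm Ad}^*_{{\rm T}_\gamma(n)})$ if on a dense open part of their common domain their differentials are linearly independent at every point and every smooth invariant, wherever it is defined, is near each point a smooth function of $F_1,\dots,F_m$. Here a function on an open set $W$ is called invariant if its value at $\xi$ equals its value at ${\rm Ad}^*_{B(1)}\xi$ whenever $B(t)$, $t\in[0,1]$, is a continuous curve in the Lie group ${\rm T}_\gamma(n)$ with $B(0)=1$ and ${\rm Ad}^*_{B(t)}\xi\in W$ for all $t$; if $W$ is ${\rm T}_\gamma(n)$-invariant, this means $F({\rm Ad}^*_B\xi)=F(\xi)$ for all $B$ and $\xi$. **Theorem.** A basis of ${\rm Inv}({\rm Ad}^*_{{\rm T}_\gamma(n)})$ consists of the expressions 1) if $\gamma_k=\gamma_\varkappa$ for all $k\in\{1,\dots,[n/2]\}$: $$|X^{\varkappa,n}_{1,k}|,\quad k=1,\dots,[n/2],\qquad x_0+\sum_{k=1}^{[n/2]}\frac{(-1)^{k+1}}{|X^{\varkappa,n}_{1,k}|}(\gamma_k-\gamma_{k+1})\sum_{k<i<\varkappa}\begin{vmatrix}X^{i,i}_{1,k}&0\\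 X^{\varkappa,n}_{1,k}&X^{\varkappa,n}_{i,i}\end{vmatrix},$$ the last one on the set where $|X^{\varkappa,n}_{1,k}|\ne0$ for all $k\in\{1,\dots,[n/2]\}$ with $\gamma_k\ne\gamma_{k+1}$; 2) otherwise, with $k_0\in\{1,\dots,[n/2]\}$ the minimal $k$ such that $\gamma_k\ne\gamma_\varkappa$: $$|X^{\varkappa,n}_{1,k}|,\quad k=1,\dots,k_0-1,\qquad |X^{\varkappa_0,n}_{1,k_0}|^{\alpha_k}\,|X^{\varkappa,n}_{1,k}|,\quad k=k_0+1,\dots,[n/2],$$ $$\alpha_k=-\sum_{i=k_0}^{k}\frac{\gamma_{n-i+1}-\gamma_i}{\gamma_{n-k_0+1}-\gamma_{k_0}}.$$ In case 2 the powers $z^{\alpha_k}$ of $z=|X^{\varkappa_0,n}_{1,k_0}|$ are understood on any open set $V$ of values $z\neq0$ as $e^{\alpha_k\ell(z)}$ for a branch $\ell$ of the logarithm on $V$, or as a continuous solution $p$ of $p(z)^b=z^a$ on $V$ if $\alpha_k=a/b$ with $a,b\in\mathbb Z$ and $b>0$ odd, or, if $\mathbb F=\mathbb R$, as the power of the absolute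 value of $z$; the corresponding invariants have the domain $|X^{\varkappa_0,n}_{1,k_0}|\in V$. -/

import Mathlib

open scoped ContDiff

namespace TriangularLie

variable {𝕜 : Type*} [RCLike 𝕜]

attribute [local instance] LieRing.ofAssociativeRing

/-! ### The Lie algebra, the Lie group and the coadjoint action

A tuple `γ₁, …, γₙ` is given as `γ : ℕ → 𝕜`, of which only the values at `1, …, n` are used.
Rows and columns of matrices are indexed by `Fin n`, so that `i : Fin n` is the `(i + 1)`-st row. -/

/-- The diagonal matrix `Γ = diag(γ₁, …, γₙ)`. -/
def Gam (n : ℕ) (γ : ℕ → 𝕜) : Matrix (Fin n) (Fin n) 𝕜 :=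
  Matrix.diagonal fun i => γ (i + 1)

theorem diag_mul {n : ℕ} {A B : Matrix (Fin n) (Fin n) 𝕜}
    (hA : A.BlockTriangular id) (hB : B.BlockTriangular id) (i : Fin n) :
    (A * B) i i = A i i * B i i := by
  rw [Matrix.mul_apply]
  refine Finset.sum_eq_single i (fun j _ hj => ?_) (by simp)
  rcases lt_or_gt_of_ne hj with h | h
  · rw [hA (show id j < id i from h), zero_mul]
  · rw [hB (show id i < id j from h), mul_zero]

/-- The Lie algebra `𝔱_γ(n)`: the upper triangular matrices whose diagonal is a multiple of `Γ`,
i.e. the span of `Γ` and of the strictly upper triangular matrices, with the commutator. -/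
def tAlg (n : ℕ) (γ : ℕ → 𝕜) : LieSubalgebra 𝕜 (Matrix (Fin n) (Fin n) 𝕜) where
  carrier := {Y | Y.BlockTriangular id ∧ ∃ y₀ : 𝕜, ∀ i : Fin n, Y i i = γ (i + 1) * y₀}
  add_mem' := by
    rintro A B ⟨hA, a, ha⟩ ⟨hB, b, hb⟩
    exact ⟨hA.add hB, a + b, fun i => by rw [Matrix.add_apply, ha, hb, mul_add]⟩
  zero_mem' := ⟨Matrix.blockTriangular_zero, 0, fun i => by simp⟩
  smul_mem' := by
    rintro c A ⟨hA, a, ha⟩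
    refine ⟨fun i j h => ?_, c * a, fun i => ?_⟩
    · rw [Matrix.smul_apply, hA h, smul_zero]
    · rw [Matrix.smul_apply, ha, smul_eq_mul]; ring
  lie_mem' := by
    rintro A B ⟨hA, a, ha⟩ ⟨hB, b, hb⟩
    refine ⟨?_, 0, fun i => ?_⟩
    · rw [Ring.lie_def]; exact (hA.mul hB).sub (hB.mul hA)
    · rw [Ring.lie_def, Matrix.sub_apply, diag_mul hA hB, diag_mul hB hA]; ring

/-- The Lie group `T_γ(n)` of the non-singular upper triangular matrices `B` with
`b_{ii} = exp(γ_i ε)` for some `ε ∈ 𝕜`. -/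
noncomputable def tGrp (n : ℕ) (γ : ℕ → 𝕜) : Subgroup (GL (Fin n) 𝕜) where
  carrier := {B | B.val.BlockTriangular id ∧
    ∃ ε : 𝕜, ∀ i : Fin n, B.val i i = NormedSpace.exp (γ (i + 1) * ε)}
  one_mem' := ⟨Matrix.blockTriangular_one, 0, fun i => by simp⟩
  mul_mem' := by
    rintro A B ⟨hA, a, ha⟩ ⟨hB, b, hb⟩
    refine ⟨hA.mul hB, a + b, fun i => ?_⟩
    rw [Units.val_mul, diag_mul hA hB, ha, hb, mul_add, NormedSpace.exp_add]
  inv_mem' := by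
    rintro A ⟨hA, a, ha⟩
    have hI : (A⁻¹).val.BlockTriangular id := by
      have := A.invertible
      rw [Matrix.coe_units_inv]
      exact Matrix.blockTriangular_inv_of_blockTriangular hA
    refine ⟨hI, -a, fun i => ?_⟩
    have h := diag_mul hA hI i
    rw [Units.mul_inv, Matrix.one_apply_eq, ha] at h
    rw [mul_neg, NormedSpace.exp_neg]
    exact (eq_inv_of_mul_eq_one_right h.symm)

theorem conj_mem {n : ℕ} {γ : ℕ → 𝕜} (B : tGrp n γ) (Y : tAlg n γ) :
    B.val.val * Y.val * (B⁻¹).val.val ∈ tAlg n γ := by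
  obtain ⟨hY, y, hy⟩ := Y.2
  have hB := B.2.1
  have hI := (B⁻¹).2.1
  refine ⟨(hB.mul hY).mul hI, y, fun i => ?_⟩
  have h := diag_mul hB hI i
  have h1 : B.val.val * (B⁻¹).val.val = 1 := by simp
  rw [h1, Matrix.one_apply_eq] at h
  rw [diag_mul (hB.mul hY) hI, diag_mul hB hY, hy]
  linear_combination (-(γ (i + 1) * y)) * h

/-- The adjoint action `Ad_B Y = B Y B⁻¹` of `T_γ(n)` on `𝔱_γ(n)`. -/
noncomputable def Ad {n : ℕ} {γ : ℕ → 𝕜} (B : tGrp n γ) : tAlg n γ →ₗ[𝕜] tAlg n γ where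
  toFun Y := ⟨B.val.val * Y.val * (B⁻¹).val.val, conj_mem B Y⟩
  map_add' Y Z := Subtype.ext (by simp [mul_add, add_mul])
  map_smul' c Y := Subtype.ext (by simp)

/-- The coadjoint action `⟨Ad*_B ξ, Y⟩ = ⟨ξ, Ad_{B⁻¹} Y⟩` of `T_γ(n)` on the dual space
`𝔱_γ(n)*`. -/
noncomputable def coAd {n : ℕ} {γ : ℕ → 𝕜} (B : tGrp n γ) (ξ : Module.Dual 𝕜 (tAlg n γ)) :
    Module.Dual 𝕜 (tAlg n γ) :=
  ξ ∘ₗ Ad B⁻¹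

/-! ### The canonical basis and the coordinates on the dual space -/

/-- The index set of the canonical basis: `none` stands for `f`, a pair `i < j` for `e_{ij}`. -/
abbrev Idx (n : ℕ) : Type := Option {p : Fin n × Fin n // p.1 < p.2}

/-- The canonical basis elements of `𝔱_γ(n)`: `f = Γ` and the matrix units `e_{ij}`, `i < j`. -/
def canon (n : ℕ) (γ : ℕ → 𝕜) : Idx n → tAlg n γ
  | none => ⟨Gam n γ, Matrix.blockTriangular_diagonal _, 1, fun i => by simp [Gam]⟩
  | some p => ⟨Matrix.single p.val.1 p.val.2 1, Matrix.blockTriangular_single p.2.le 1, 0,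
      fun i => by
        have h := p.2
        rw [mul_zero, Matrix.single_apply_of_ne]
        rintro ⟨h1, h2⟩
        exact absurd (h1.trans h2.symm) h.ne⟩

/-- The coordinates of a functional `ξ ∈ 𝔱_γ(n)*`: `x₀ = ξ(f)` (at the index `none`) and
`x_{ji} = ξ(e_{ij})`, `i < j` (at the index `some (i, j)`). -/
def coords (n : ℕ) (γ : ℕ → 𝕜) (ξ : Module.Dual 𝕜 (tAlg n γ)) : Idx n → 𝕜 :=
  fun p => ξ (canon n γ p)

/-- The coordinates identify the dual space with the coordinate space, as soon as the `γ_i` do not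
all vanish. -/
theorem coords_bijective (n : ℕ) (γ : ℕ → 𝕜) (i₀ : Fin n) (h₀ : γ (i₀ + 1) ≠ 0) :
    Function.Bijective (coords n γ) := by
  constructor
  · intro ξ η h
    refine LinearMap.ext fun Y => ?_
    obtain ⟨hY, y, hy⟩ := Y.2
    have key : Y = y • canon n γ none + ∑ p : {p : Fin n × Fin n // p.1 < p.2},
        Y.val p.val.1 p.val.2 • canon n γ (some p) := by
      refine Subtype.ext (Matrix.ext fun i j => ?_)
      have hsum : ((∑ p : {p : Fin n × Fin n // p.1 < p.2},
          Y.val p.val.1 p.val.2 • canon n γ (some p) : tAlg n γ) : Matrix (Fin n) (Fin n) 𝕜) i j =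
          ∑ p : {p : Fin n × Fin n // p.1 < p.2},
            Y.val p.val.1 p.val.2 * Matrix.single p.val.1 p.val.2 (1 : 𝕜) i j := by
        rw [← LieSubalgebra.coe_incl, map_sum, Matrix.sum_apply]
        rfl
      change Y.val i j = y * Gam n γ i j + ((∑ p : {p : Fin n × Fin n // p.1 < p.2},
          Y.val p.val.1 p.val.2 • canon n γ (some p) : tAlg n γ) : Matrix (Fin n) (Fin n) 𝕜) i j
      rw [hsum]
      rcases lt_trichotomy i j with hij | rfl | hij
      · rw [Finset.sum_eq_single ⟨(i, j), hij⟩]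
        · simp [Gam, hij.ne]
        · rintro ⟨⟨a, b⟩, hab⟩ - hne
          rw [Matrix.single_apply_of_ne, mul_zero]
          rintro ⟨rfl, rfl⟩
          exact hne rfl
        · simp
      · rw [Finset.sum_eq_zero]
        · rw [hy]; simp [Gam, mul_comm]
        · rintro ⟨⟨a, b⟩, hab⟩ -
          rw [Matrix.single_apply_of_ne, mul_zero]
          rintro ⟨h1, h2⟩
          exact absurd (h1.trans h2.symm) hab.ne
      · rw [Finset.sum_eq_zero]
        · rw [hY hij]; simp [Gam, hij.ne']
        · rintro ⟨⟨a, b⟩, hab⟩ -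
          rw [Matrix.single_apply_of_ne, mul_zero]
          rintro ⟨rfl, rfl⟩
          exact lt_asymm hab hij
    rw [key]
    simp only [map_add, map_smul, map_sum]
    congr 1
    · exact congrArg (y • ·) (congrFun h none)
    · exact Finset.sum_congr rfl fun p _ =>
        congrArg (Y.val p.val.1 p.val.2 • ·) (congrFun h (some p))
  · intro x
    let ξ : Module.Dual 𝕜 (tAlg n γ) :=
      { toFun := fun Y => Y.val i₀ i₀ / γ (i₀ + 1) * x none +
          ∑ p : {p : Fin n × Fin n // p.1 < p.2}, Y.val p.val.1 p.val.2 * x (some p)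
        map_add' := fun Y Z => by
          have h : ∀ i j, (Y + Z).val i j = Y.val i j + Z.val i j := fun _ _ => rfl
          simp only [h, add_mul, add_div, Finset.sum_add_distrib]
          ring
        map_smul' := fun c Y => by
          have h : ∀ i j, (c • Y).val i j = c * Y.val i j := fun _ _ => rfl
          simp only [h, smul_eq_mul, RingHom.id_apply, mul_add, Finset.mul_sum]
          congr 1
          · ring
          · exact Finset.sum_congr rfl fun p _ => by ring }
    refine ⟨ξ, funext fun q => ?_⟩
    rcases q with _ | ⟨⟨i, j⟩, hij⟩
    · change Gam n γ i₀ i₀ / γ (i₀ + 1) * x none + ∑ p : {p : Fin n × Fin n // p.1 < p.2},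
        Gam n γ p.val.1 p.val.2 * x (some p) = x none
      rw [Finset.sum_eq_zero fun p _ => by simp [Gam, p.2.ne]]
      simp [Gam, h₀]
    · change Matrix.single i j (1 : 𝕜) i₀ i₀ / γ (i₀ + 1) * x none +
        ∑ p : {p : Fin n × Fin n // p.1 < p.2},
          Matrix.single i j (1 : 𝕜) p.val.1 p.val.2 * x (some p) = x (some ⟨(i, j), hij⟩)
      have hij' : i ≠ j := ne_of_lt hij
      rw [Matrix.single_apply_of_ne _ _ _ _ _ (by rintro ⟨rfl, rfl⟩; exact hij' rfl),
        Finset.sum_eq_single ⟨(i, j), hij⟩]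
      · simp
      · rintro ⟨⟨a, b⟩, hab⟩ - hne
        rw [Matrix.single_apply_of_ne, zero_mul]
        rintro ⟨rfl, rfl⟩
        exact hne rfl
      · simp

/-! ### Invariants and their bases

Functions on (parts of) `𝔱_γ(n)*` are written as functions of the coordinates. -/

/-- `F` is invariant under the coadjoint action on the part `W` of the dual space: the value of
`F` does not change along a curve `t ↦ Ad*_{B(t)} ξ` in `W`, where `B(t)` is a curve in the Lie
group `T_γ(n)` (that is, `ε` and the entries of `B` depend continuously on `t`) with `B(0) = 1`.
As `T_γ(n)` is connected, on a `T_γ(n)`-invariant set `W` this says precisely that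
`F(Ad*_B ξ) = F(ξ)` for all `B ∈ T_γ(n)` and `ξ ∈ W`. -/
def IsInvariantOn (n : ℕ) (γ : ℕ → 𝕜) (W : Set (Idx n → 𝕜)) (F : (Idx n → 𝕜) → 𝕜) : Prop :=
  ∀ (ξ : Module.Dual 𝕜 (tAlg n γ)) (B : unitInterval → tGrp n γ) (ε : unitInterval → 𝕜),
    Continuous ε → Continuous (fun t => (B t).val.val) →
    (∀ t, ∀ i : Fin n, (B t).val.val i i = NormedSpace.exp (γ (i + 1) * ε t)) →
    B 0 = 1 → (∀ t, coords n γ (coAd (B t) ξ) ∈ W) →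
    F (coords n γ (coAd (B 1) ξ)) = F (coords n γ ξ)

/-- The functions `F l`, `l ∈ ι`, with the domains `dom l`, form a (functional) basis of the set
`Inv(Ad*)` of invariants of the coadjoint action of `T_γ(n)`:
* each `F l` is a smooth (holomorphic if `𝕜 = ℂ`) invariant on its open domain;
* on a dense open part of the common domain the `F l` are functionally independent, and near each
  point of that part every smooth invariant, wherever it is defined, is a smooth function of
  the `F l`. -/
structure IsInvariantBasis (n : ℕ) (γ : ℕ → 𝕜) {ι : Type} [Fintype ι]
    (dom : ι → Set (Idx n → 𝕜)) (F : ι → (Idx n → 𝕜) → 𝕜) : Prop where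
  isOpen_dom : ∀ l, IsOpen (dom l)
  smooth : ∀ l, ContDiffOn 𝕜 ∞ (F l) (dom l)
  invariant : ∀ l, IsInvariantOn n γ (dom l) (F l)
  generic : ∃ U : Set (Idx n → 𝕜), IsOpen U ∧ U ⊆ ⋂ l, dom l ∧ ⋂ l, dom l ⊆ closure U ∧
    (∀ x ∈ U, LinearIndependent 𝕜 fun l => fderiv 𝕜 (F l) x) ∧
    ∀ (W : Set (Idx n → 𝕜)) (H : (Idx n → 𝕜) → 𝕜), IsOpen W → ContDiffOn 𝕜 ∞ H W →
      IsInvariantOn n γ W H → ∀ x ∈ W ∩ U, ∃ Φ : (ι → 𝕜) → 𝕜,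
        ContDiffAt 𝕜 ∞ Φ (fun l => F l x) ∧ ∀ᶠ y in nhds x, H y = Φ fun l => F l y

/-! ### The explicit expressions -/

/-- The entry `x_{ij}` (`1 ≤ i, j ≤ n`) of the strictly lower triangular matrix `X`: a coordinate
if `j < i`, and `0` otherwise. -/
def X {n : ℕ} (x : Idx n → 𝕜) (i j : ℕ) : 𝕜 :=
  if h : 1 ≤ j ∧ j < i ∧ i ≤ n then
    x (some ⟨(⟨j - 1, by omega⟩, ⟨i - 1, by omega⟩), by
      simp only [Fin.mk_lt_mk]; omega⟩)
  else 0

/-- The lower left corner minor `|X^{ϰ,n}_{1,k}|`, `ϰ = n - k + 1`. -/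
def minor {n : ℕ} (k : ℕ) (x : Idx n → 𝕜) : 𝕜 :=
  Matrix.det (Matrix.of fun a b : Fin k => X x (n - k + 1 + a) (b + 1))

/-- The determinant of order `k + 1` with the first row `(X^{i,i}_{1,k}, 0)` and the further rows
`(X^{ϰ,n}_{1,k}, X^{ϰ,n}_{i,i})`, `ϰ = n - k + 1`. -/
def bordered {n : ℕ} (k i : ℕ) (x : Idx n → 𝕜) : 𝕜 :=
  Matrix.det (Matrix.of (Fin.cons
    (Fin.snoc (fun b : Fin k => X x i (b + 1)) 0)
    (fun a : Fin k => Fin.snoc (fun b : Fin k => X x (n - k + 1 + a) (b + 1))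
      (X x (n - k + 1 + a) i)) : Fin (k + 1) → Fin (k + 1) → 𝕜))

/-- The invariant of the singular case that involves `x₀`. -/
noncomputable def singInv {n : ℕ} (γ : ℕ → 𝕜) (x : Idx n → 𝕜) : 𝕜 :=
  x none + ∑ k ∈ Finset.Icc 1 (n / 2),
    (-1) ^ (k + 1) / minor k x * (γ k - γ (k + 1)) *
      ∑ i ∈ Finset.Ioo k (n - k + 1), bordered k i x

/-- The exponents `α_k = -∑_{i=k₀}^{k} (γ_{n-i+1} - γ_i) / (γ_{n-k₀+1} - γ_{k₀})`. -/
noncomputable def expo (n : ℕ) (γ : ℕ → 𝕜) (k₀ k : ℕ) : 𝕜 :=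
  -∑ i ∈ Finset.Icc k₀ k, (γ (n - i + 1) - γ i) / (γ (n - k₀ + 1) - γ k₀)

/-- `p` is a determination of the power function `z ↦ z ^ α` on the set `V`, `0 ∉ V`:
* `z ^ α = exp(α ℓ(z))` for a branch `ℓ` of the logarithm on `V` (the usual power of positive
  numbers if `𝕜 = ℝ`);
* a continuous solution of `p(z) ^ b = z ^ a` if `α = a / b` is rational with an odd denominator
  (the usual integer power if `b = 1`);
* the power `|z| ^ α` of the absolute value if `𝕜 = ℝ`. -/
inductive IsPowerOn (α : 𝕜) (V : Set 𝕜) (p : 𝕜 → 𝕜) : Prop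
  | ofLog (l : 𝕜 → 𝕜) (hl : ContinuousOn l V) (hexp : ∀ z ∈ V, NormedSpace.exp (l z) = z)
      (hp : ∀ z ∈ V, p z = NormedSpace.exp (α * l z))
  | ofRoot (a : ℤ) (b : ℕ) (hb : Odd b) (hα : α = (a : 𝕜) / (b : 𝕜)) (h0 : (0 : 𝕜) ∉ V)
      (hc : ContinuousOn p V) (hp : ∀ z ∈ V, p z ^ b = z ^ a)
  | ofAbs (hreal : ∀ z : 𝕜, (starRingEnd 𝕜) z = z) (h0 : (0 : 𝕜) ∉ V)
      (hp : ∀ z ∈ V, p z = ((‖z‖ ^ RCLike.re α : ℝ) : 𝕜))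

end TriangularLie

/-!
Let `L` be the strictly lower triangular matrix of the coordinates `x_{ij}`. The coadjoint action
of `B` replaces `L` by the part of `Z = B L B⁻¹` below the diagonal and adds `tr (Γ Z)` to `x₀`.
Let `C` be the first `k` and `R` the last `k` indices, with `2 k ≤ n`, and let `M = Z_{R,C}`.

*Invariance.* As `B` is triangular, `M` is multiplied by the diagonal blocks `B_{R,R}` and
`(B⁻¹)_{C,C}` (`corner_mul_mul`), so the corner minor `m_k = det M` is multiplied by
`exp(w_k ε)` with `w_k = ∑_{i ≤ k} (γ_{n-i+1} - γ_i)` (`minor_coAd`). This settles the expressions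
without `x₀`; a determination `p` of the power `α` enters only through `p' = α p / z`
(`IsPowerOn.hasDerivAt`), by which the product is locally constant in `ε`.
For the expression with `x₀` the bordered determinants are Schur complements `Z_{i,C} M⁻¹ Z_{R,i}`
up to the factor `± m_k`. Their sum over the middle indices `i` differs from the conjugation
invariant `tr (M⁻¹ (Z²)_{R,C})` by the sum of the diagonal entries of `Z` over `C` and `R`
(`cornerTrace_eq_sum`), and Abel summation turns the weighted sum of these into `tr (Γ Z)`
(`singInv_conj`).

*Completeness.* By the inverse function theorem it suffices that at generic points the
differentials of the listed functions are linearly independent and span the differentials of all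
invariants (`exists_eventuallyEq_comp`). The differential of an invariant annihilates the tangent
space of the orbit. If it also annihilates `∂/∂x₀`, its coefficients form a strictly upper
triangular `Y` with `[L, Y]` zero below the diagonal, and such a `Y` is determined by its entries
on the antidiagonal (`eq_zero_of_antidiagonal`). The differentials of `m_1, …, m_{[n/2]}` are
covectors of this kind, and their matrix at the antidiagonal coordinates is triangular with the
diagonal `± m_{k-1}`. Hence they are a basis of these covectors (`exists_eq_sum_fderiv_minor`).
In the singular case one subtracts a multiple of the differential of the expression with `x₀`. In
the other case `∂/∂x₀` is itself tangent to the orbit, being proportional to the velocity of `M⁻¹`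
for `k = k₀` (`weight_mul_eq_zero`), and the torus imposes one relation on the coefficients, which
leaves exactly the span of the differentials of the listed functions.
-/

namespace TriangularLie

variable {𝕜 : Type*} [RCLike 𝕜]

attribute [local instance] LieRing.ofAssociativeRing

/-! ### The coadjoint action in coordinates -/

/-- The strictly lower triangular matrix `X` of the coordinates `x_{ij}`, `j < i`. -/
def low {n : ℕ} (x : Idx n → 𝕜) : Matrix (Fin n) (Fin n) 𝕜 :=
  Matrix.of fun i j => if h : j < i then x (some ⟨(j, i), h⟩) else 0

/-- The point with `x₀ = c` whose other coordinates are the entries of `Z` below the diagonal. -/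
def ofLow {n : ℕ} (c : 𝕜) (Z : Matrix (Fin n) (Fin n) 𝕜) : Idx n → 𝕜
  | none => c
  | some p => Z p.val.2 p.val.1

theorem low_apply_of_lt {n : ℕ} (x : Idx n → 𝕜) {i j : Fin n} (h : j < i) :
    low x i j = x (some ⟨(j, i), h⟩) := by
  simp [low, h]

theorem low_apply_of_le {n : ℕ} (x : Idx n → 𝕜) {i j : Fin n} (h : i ≤ j) : low x i j = 0 := by
  simp [low, not_lt.2 h]

theorem ofLow_low {n : ℕ} (x : Idx n → 𝕜) : ofLow (x none) (low x) = x := by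
  funext p
  rcases p with _ | ⟨⟨i, j⟩, hij⟩
  · rfl
  · exact low_apply_of_lt x hij

theorem low_ofLow_of_lt {n : ℕ} (c : 𝕜) (Z : Matrix (Fin n) (Fin n) 𝕜) {i j : Fin n} (h : j < i) :
    low (ofLow c Z) i j = Z i j := by
  rw [low_apply_of_lt _ h]; rfl

theorem trace_low {n : ℕ} (x : Idx n → 𝕜) : (low x).trace = 0 :=
  Finset.sum_eq_zero fun _ _ => low_apply_of_le x le_rfl

theorem X_eq_low {n : ℕ} (x : Idx n → 𝕜) (i j : Fin n) : X x (i + 1) (j + 1) = low x i j := by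
  unfold X
  rcases lt_or_ge j i with h | h
  · rw [dif_pos ⟨by omega, by simpa using h, by omega⟩, low_apply_of_lt x h]
    congr
  · rw [dif_neg (by rw [Fin.le_def] at h; omega), low_apply_of_le x h]

theorem sum_eq_sum_pairs {n : ℕ} (f : Fin n → Fin n → 𝕜) (hf : ∀ i j, ¬ i < j → f i j = 0) :
    ∑ i, ∑ j, f i j = ∑ p : {p : Fin n × Fin n // p.1 < p.2}, f p.val.1 p.val.2 := by
  rw [← Fintype.sum_prod_type']
  refine (Fintype.sum_of_injective Subtype.val Subtype.val_injective _ _ (fun q hq => ?_)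
    fun _ => rfl).symm
  exact hf _ _ fun h => hq ⟨⟨q, h⟩, rfl⟩

/-- A functional is determined by its coordinates: on `Y ∈ 𝔱_γ(n)` with the diagonal `y₀ Γ` it
takes the value `y₀ x₀ + tr (X Y)`. -/
theorem dual_apply {n : ℕ} {γ : ℕ → 𝕜} (ξ : Module.Dual 𝕜 (tAlg n γ)) (Y : tAlg n γ) (y : 𝕜)
    (hy : ∀ i : Fin n, Y.val i i = γ (i + 1) * y) :
    ξ Y = y * coords n γ ξ none + (low (coords n γ ξ) * Y.val).trace := by
  have key : Y = y • canon n γ none + ∑ p : {p : Fin n × Fin n // p.1 < p.2},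
      Y.val p.val.1 p.val.2 • canon n γ (some p) := by
    refine Subtype.ext (Matrix.ext fun i j => ?_)
    have hsum : ((∑ p : {p : Fin n × Fin n // p.1 < p.2},
        Y.val p.val.1 p.val.2 • canon n γ (some p) : tAlg n γ) : Matrix (Fin n) (Fin n) 𝕜) i j =
        ∑ p : {p : Fin n × Fin n // p.1 < p.2},
          Y.val p.val.1 p.val.2 * Matrix.single p.val.1 p.val.2 (1 : 𝕜) i j := by
      rw [← LieSubalgebra.coe_incl, map_sum, Matrix.sum_apply]
      rfl
    change Y.val i j = y * Gam n γ i j + ((∑ p : {p : Fin n × Fin n // p.1 < p.2},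
        Y.val p.val.1 p.val.2 • canon n γ (some p) : tAlg n γ) : Matrix (Fin n) (Fin n) 𝕜) i j
    rw [hsum]
    by_cases hij : i < j
    · rw [Finset.sum_eq_single ⟨(i, j), hij⟩]
      · simp [Gam, hij.ne]
      · rintro ⟨⟨a, b⟩, hab⟩ - hne
        rw [Matrix.single_apply_of_ne, mul_zero]
        rintro ⟨rfl, rfl⟩
        exact hne rfl
      · simp
    · rw [Finset.sum_eq_zero, add_zero]
      · rcases (not_lt.1 hij).lt_or_eq with h | rfl
        · rw [Y.2.1 h]; simp [Gam, h.ne']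
        · rw [hy]; simp [Gam, mul_comm]
      · rintro ⟨⟨a, b⟩, hab⟩ -
        rw [Matrix.single_apply_of_ne, mul_zero]
        rintro ⟨rfl, rfl⟩
        exact hij hab
  have htr : (low (coords n γ ξ) * Y.val).trace = ∑ p : {p : Fin n × Fin n // p.1 < p.2},
      Y.val p.val.1 p.val.2 * coords n γ ξ (some p) := by
    rw [Matrix.trace_mul_comm]
    simp only [Matrix.trace, Matrix.diag_apply, Matrix.mul_apply]
    rw [sum_eq_sum_pairs fun i j => Y.val i j * low (coords n γ ξ) j i]
    · exact Finset.sum_congr rfl fun p _ => by rw [low_apply_of_lt _ p.2]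
    · intro i j h
      rw [low_apply_of_le _ (not_lt.1 h), mul_zero]
  rw [htr]
  conv_lhs => rw [key]
  simp only [map_add, map_smul, map_sum, smul_eq_mul]
  rfl

/-- The coadjoint action in coordinates: `X` goes to the part of `B X B⁻¹` below the diagonal, and
`x₀` to `x₀ + tr (Γ B X B⁻¹)`. -/
theorem coords_coAd {n : ℕ} {γ : ℕ → 𝕜} (B : tGrp n γ) (ξ : Module.Dual 𝕜 (tAlg n γ)) :
    coords n γ (coAd B ξ) =
      ofLow (coords n γ ξ none +
          (Gam n γ * (B.val.val * low (coords n γ ξ) * (B⁻¹).val.val)).trace)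
        (B.val.val * low (coords n γ ξ) * (B⁻¹).val.val) := by
  have hAd : ∀ Y : tAlg n γ, (Ad B⁻¹ Y).val = (B⁻¹).val.val * Y.val * B.val.val := fun Y => by
    change (B⁻¹).val.val * Y.val * (B⁻¹⁻¹).val.val = _
    rw [inv_inv]
  have hdiag : ∀ (Y : tAlg n γ) (i : Fin n), (Ad B⁻¹ Y).val i i = Y.val i i := fun Y i => by
    have h1 : (B⁻¹).val.val * B.val.val = 1 := by simp
    have h2 := diag_mul (B⁻¹).2.1 B.2.1 i
    rw [h1, Matrix.one_apply_eq] at h2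
    rw [hAd, diag_mul ((B⁻¹).2.1.mul Y.2.1) B.2.1, diag_mul (B⁻¹).2.1 Y.2.1]
    linear_combination (-(Y.val i i)) * h2
  have htr : ∀ Y : tAlg n γ, (low (coords n γ ξ) * (Ad B⁻¹ Y).val).trace =
      (Y.val * (B.val.val * low (coords n γ ξ) * (B⁻¹).val.val)).trace := fun Y => by
    rw [hAd, Matrix.trace_mul_comm, ← Matrix.trace_mul_comm _ Y.val]
    simp only [Matrix.mul_assoc]
    rw [Matrix.trace_mul_comm]
    simp only [Matrix.mul_assoc]
    rw [Matrix.trace_mul_comm]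
    simp only [Matrix.mul_assoc]
  funext p
  rcases p with _ | ⟨⟨i, j⟩, hij⟩
  · change ξ (Ad B⁻¹ (canon n γ none)) = _
    rw [dual_apply ξ _ 1 fun i => by rw [hdiag]; simp [canon, Gam], htr, one_mul]
    rfl
  · change ξ (Ad B⁻¹ (canon n γ (some ⟨(i, j), hij⟩))) = _
    have hne : i ≠ j := ne_of_lt hij
    rw [dual_apply ξ _ 0 fun l => by
      rw [hdiag, mul_zero]
      exact Matrix.single_apply_of_ne _ _ _ _ _ (by rintro ⟨h1, h2⟩; exact hne (h1.trans h2.symm)),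
      htr, zero_mul, zero_add]
    change (Matrix.single i j (1 : 𝕜) * _).trace = _
    rw [Matrix.trace_mul_comm, Matrix.trace_mul_single]
    simp [ofLow]

/-! ### The lower left corners -/

/-- The index of the `(a + 1)`-st of the last `k` rows. -/
def botIdx {n k : ℕ} (h : k ≤ n) (a : Fin k) : Fin n := ⟨n - k + a, by omega⟩

theorem botIdx_injective {n k : ℕ} (h : k ≤ n) : Function.Injective (botIdx h) := fun a b hab => by
  simp only [botIdx, Fin.mk.injEq] at hab
  exact Fin.ext (by omega)

/-- The lower left `k × k` corner of a matrix. -/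
def corner {n k : ℕ} (h : k ≤ n) (Z : Matrix (Fin n) (Fin n) 𝕜) : Matrix (Fin k) (Fin k) 𝕜 :=
  Z.submatrix (botIdx h) (Fin.castLE h)

theorem sum_eq_sum_castLE {n k : ℕ} (h : k ≤ n) (f : Fin n → 𝕜)
    (hf : ∀ l : Fin n, k ≤ l.val → f l = 0) : ∑ l, f l = ∑ b : Fin k, f (Fin.castLE h b) := by
  refine (Fintype.sum_of_injective (Fin.castLE h) (Fin.castLE_injective h) _ _ (fun l hl => ?_)
    fun _ => rfl).symm
  refine hf l (not_lt.1 fun hlt => hl ⟨⟨l, hlt⟩, rfl⟩)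

theorem sum_eq_sum_botIdx {n k : ℕ} (h : k ≤ n) (f : Fin n → 𝕜)
    (hf : ∀ l : Fin n, l.val < n - k → f l = 0) : ∑ l, f l = ∑ a : Fin k, f (botIdx h a) := by
  refine (Fintype.sum_of_injective (botIdx h) (botIdx_injective h) _ _ (fun l hl => ?_)
    fun _ => rfl).symm
  refine hf l (not_le.1 fun hle => hl ⟨⟨l - (n - k), by omega⟩, Fin.ext ?_⟩)
  simp only [botIdx]; omega

/-- A minor in the lower left corner of order at most `n / 2` lies below the diagonal. -/
theorem minor_ofLow {n k : ℕ} (h : k ≤ n) (hk : 2 * k ≤ n) (c : 𝕜)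
    (Z : Matrix (Fin n) (Fin n) 𝕜) : minor k (ofLow c Z) = (corner h Z).det := by
  unfold minor corner
  congr 1
  ext a b
  have hX := X_eq_low (ofLow c Z) (botIdx h a) (Fin.castLE h b)
  rw [low_ofLow_of_lt _ _ (by rw [Fin.lt_def]; simp only [botIdx, Fin.val_castLE]; omega)] at hX
  rw [Matrix.submatrix_apply, ← hX, Matrix.of_apply]
  congr 1
  simp only [botIdx]; omega

theorem minor_eq_det_corner {n k : ℕ} (h : k ≤ n) (hk : 2 * k ≤ n) (x : Idx n → 𝕜) :
    minor k x = (corner h (low x)).det := by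
  conv_lhs => rw [← ofLow_low x]
  exact minor_ofLow h hk _ _

/-- Multiplication by upper triangular matrices acts on the lower left corner through the diagonal
blocks. -/
theorem corner_mul_mul {n k : ℕ} (h : k ≤ n) {A B : Matrix (Fin n) (Fin n) 𝕜}
    (hA : A.BlockTriangular id) (hB : B.BlockTriangular id) (Z : Matrix (Fin n) (Fin n) 𝕜) :
    corner h (A * Z * B) = A.submatrix (botIdx h) (botIdx h) * corner h Z *
      B.submatrix (Fin.castLE h) (Fin.castLE h) := by
  ext a b
  simp only [corner, Matrix.submatrix_apply, Matrix.mul_apply]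
  rw [sum_eq_sum_castLE h]
  · refine Finset.sum_congr rfl fun c _ => ?_
    rw [sum_eq_sum_botIdx h]
    intro l hl
    rw [hA (show id l < id (botIdx h a) by
      simp only [id, Fin.lt_def, botIdx]; omega), zero_mul]
  · intro l hl
    rw [hB (show id (Fin.castLE h b) < id l by
      simp only [id, Fin.lt_def, Fin.val_castLE]; omega), mul_zero]

/-! ### The corner minors under the group and along the antidiagonal coordinates -/

theorem blockTriangular_submatrix {n k : ℕ} {A : Matrix (Fin n) (Fin n) 𝕜}
    (hA : A.BlockTriangular id) {e : Fin k → Fin n} (he : StrictMono e) :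
    (A.submatrix e e).BlockTriangular id := fun _ _ hij => hA (he hij)

theorem botIdx_strictMono {n k : ℕ} (h : k ≤ n) : StrictMono (botIdx h) := fun a b hab => by
  simp only [botIdx, Fin.mk_lt_mk]
  exact Nat.add_lt_add_left hab _

theorem castLE_strictMono {n k : ℕ} (h : k ≤ n) : StrictMono (Fin.castLE h) := fun _ _ hab => hab

theorem det_submatrix_triangular {n k : ℕ} {A : Matrix (Fin n) (Fin n) 𝕜}
    (hA : A.BlockTriangular id) {e : Fin k → Fin n} (he : StrictMono e) :
    (A.submatrix e e).det = ∏ a, A (e a) (e a) :=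
  Matrix.det_of_isUpperTriangular (blockTriangular_submatrix hA he)

theorem minor_conj {n k : ℕ} (h : k ≤ n) (hk : 2 * k ≤ n) {A B : Matrix (Fin n) (Fin n) 𝕜}
    (hA : A.BlockTriangular id) (hB : B.BlockTriangular id) (c : 𝕜) (x : Idx n → 𝕜) :
    minor k (ofLow c (A * low x * B)) =
      (∏ a, A (botIdx h a) (botIdx h a)) * minor k x *
        ∏ b, B (Fin.castLE h b) (Fin.castLE h b) := by
  rw [minor_ofLow h hk, corner_mul_mul h hA hB, Matrix.det_mul, Matrix.det_mul,
    minor_eq_det_corner h hk, det_submatrix_triangular hA (botIdx_strictMono h),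
    det_submatrix_triangular hB (castLE_strictMono h)]

theorem minor_zero {n : ℕ} (x : Idx n → 𝕜) : minor 0 x = 1 := Matrix.det_fin_zero

/-- The index of the coordinate `x_{n-k, k+1}` on the antidiagonal of `X`. -/
def antiIdx {n k : ℕ} (h : 2 * (k + 1) ≤ n) : Idx n :=
  some ⟨(⟨k, by omega⟩, ⟨n - (k + 1), by omega⟩), by simp only [Fin.mk_lt_mk]; omega⟩

theorem X_antiIdx {n k : ℕ} (h : 2 * (k + 1) ≤ n) (x : Idx n → 𝕜) (t : 𝕜) (i j : ℕ) :
    X (x + t • Pi.single (antiIdx h) 1) i j =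
      X x i j + if i = n - k ∧ j = k + 1 then t else 0 := by
  unfold X
  by_cases hij : 1 ≤ j ∧ j < i ∧ i ≤ n
  · rw [dif_pos hij, dif_pos hij]
    by_cases he : i = n - k ∧ j = k + 1
    · rw [if_pos he]
      obtain ⟨rfl, rfl⟩ := he
      have : (some ⟨(⟨k + 1 - 1, by omega⟩, ⟨n - k - 1, by omega⟩), by
          simp only [Fin.mk_lt_mk]; omega⟩ : Idx n) = antiIdx h := by
        simp only [antiIdx, Option.some.injEq, Subtype.mk.injEq, Prod.mk.injEq, Fin.mk.injEq]
        omega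
      rw [Pi.add_apply, Pi.smul_apply, this, Pi.single_eq_same, smul_eq_mul, mul_one]
    · rw [if_neg he, Pi.add_apply, Pi.smul_apply, Pi.single_eq_of_ne, smul_zero]
      simp only [antiIdx, ne_eq, Option.some.injEq, Subtype.mk.injEq, Prod.mk.injEq, Fin.mk.injEq]
      omega
  · rw [dif_neg hij, dif_neg hij, if_neg (by omega), add_zero]

/-- The coordinate `x_{n-k, k+1}` is the top right entry of the corner of order `k + 1`, and its
cofactor is the corner minor of order `k`. -/
theorem minor_succ_add {n k : ℕ} (h : 2 * (k + 1) ≤ n) (x : Idx n → 𝕜) (t : 𝕜) :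
    minor (k + 1) (x + t • Pi.single (antiIdx h) 1) =
      minor (k + 1) x + t * ((-1) ^ k * minor k x) := by
  set N : (Idx n → 𝕜) → Matrix (Fin (k + 1)) (Fin (k + 1)) 𝕜 := fun y =>
    Matrix.of fun a b => X y (n - (k + 1) + 1 + a) (b + 1) with hN
  set y := x + t • Pi.single (antiIdx h) 1 with hy
  have hrest : ∀ b : Fin (k + 1), (N y).submatrix Fin.succ b.succAbove =
      (N x).submatrix Fin.succ b.succAbove := fun b => by
    ext a c
    simp only [hN, hy, Matrix.submatrix_apply, Matrix.of_apply, Fin.val_succ, X_antiIdx]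
    rw [if_neg (by omega), add_zero]
  have hinit : ∀ b : Fin k, N y 0 b.castSucc = N x 0 b.castSucc := fun b => by
    simp only [hN, hy, Matrix.of_apply, X_antiIdx]
    rw [if_neg (by rw [Fin.val_castSucc]; omega), add_zero]
  have hlast : N y 0 (Fin.last k) = N x 0 (Fin.last k) + t := by
    simp only [hN, hy, Matrix.of_apply, X_antiIdx]
    rw [if_pos (by rw [Fin.val_zero, Fin.val_last]; omega)]
  have hsub : ((N x).submatrix Fin.succ (Fin.last k).succAbove).det = minor k x := by
    unfold minor
    congr 1
    ext a b
    simp only [hN, Matrix.submatrix_apply, Matrix.of_apply, Fin.succAbove_last, Fin.val_succ,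
      Fin.val_castSucc]
    congr 1
    omega
  change (N y).det = (N x).det + _
  rw [Matrix.det_succ_row_zero, Matrix.det_succ_row_zero, Fin.sum_univ_castSucc,
    Fin.sum_univ_castSucc]
  simp only [hrest, hinit, hlast, hsub, Fin.val_last]
  ring

theorem minor_add_of_le {n k l : ℕ} (h : 2 * (k + 1) ≤ n) (hl : l ≤ k) (x : Idx n → 𝕜) (t : 𝕜) :
    minor l (x + t • Pi.single (antiIdx h) 1) = minor l x := by
  unfold minor
  congr 1
  ext a b
  simp only [Matrix.of_apply, X_antiIdx]
  rw [if_neg (by omega), add_zero]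

/-! ### The invariant that involves `x₀` -/

/-- The value `Z_{l,C} M⁻¹ Z_{R,l}`, where `C` are the first `k` columns, `R` the last `k` rows and
`M = Z_{R,C}`. -/
noncomputable def through {n k : ℕ} (h : k ≤ n) (Z : Matrix (Fin n) (Fin n) 𝕜) (l : Fin n) : 𝕜 :=
  ∑ a, ∑ b, Z l (Fin.castLE h b) * (corner h Z)⁻¹ b a * Z (botIdx h a) l

/-- The trace of `M⁻¹ (Z²)_{R,C}`, where `C` are the first `k` columns, `R` the last `k` rows and
`M = Z_{R,C}`. -/
noncomputable def cornerTrace {n k : ℕ} (h : k ≤ n) (Z : Matrix (Fin n) (Fin n) 𝕜) : 𝕜 :=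
  ((corner h Z)⁻¹ * corner h (Z * Z)).trace

theorem cornerTrace_conj {n k : ℕ} (h : k ≤ n) {B B' : Matrix (Fin n) (Fin n) 𝕜}
    (hB : B.BlockTriangular id) (hB' : B'.BlockTriangular id) (hBB' : B * B' = 1)
    (Z : Matrix (Fin n) (Fin n) 𝕜) :
    cornerTrace h (B * Z * B') = cornerTrace h Z := by
  have hne : ∀ i, B i i ≠ 0 ∧ B' i i ≠ 0 := fun i => by
    have h1 := diag_mul hB hB' i
    rw [hBB', Matrix.one_apply_eq] at h1
    exact ⟨left_ne_zero_of_mul (h1 ▸ one_ne_zero), right_ne_zero_of_mul (h1 ▸ one_ne_zero)⟩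
  have hu : IsUnit (B.submatrix (botIdx h) (botIdx h)).det := by
    rw [det_submatrix_triangular hB (botIdx_strictMono h), isUnit_iff_ne_zero,
      Finset.prod_ne_zero_iff]
    exact fun a _ => (hne _).1
  have hv : IsUnit (B'.submatrix (Fin.castLE h) (Fin.castLE h)).det := by
    rw [det_submatrix_triangular hB' (castLE_strictMono h), isUnit_iff_ne_zero,
      Finset.prod_ne_zero_iff]
    exact fun a _ => (hne _).2
  have hsq : B * Z * B' * (B * Z * B') = B * (Z * Z) * B' := by
    have h2 : B' * B = 1 := mul_eq_one_comm.1 hBB'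
    calc B * Z * B' * (B * Z * B') = B * Z * (B' * B) * Z * B' := by simp only [Matrix.mul_assoc]
      _ = _ := by rw [h2, Matrix.mul_one, Matrix.mul_assoc B]
  unfold cornerTrace
  rw [hsq, corner_mul_mul h hB hB', corner_mul_mul h hB hB', Matrix.mul_inv_rev,
    Matrix.mul_inv_rev, ← Matrix.mul_assoc, Matrix.trace_mul_comm]
  simp only [← Matrix.mul_assoc]
  rw [Matrix.mul_nonsing_inv _ hv, Matrix.one_mul, Matrix.mul_assoc (corner h Z)⁻¹,
    Matrix.nonsing_inv_mul _ hu, Matrix.mul_one]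

/-- For `l ∈ C` and `l ∈ R` the terms of the trace of `M⁻¹ Z_{R,·} Z_{·,C}` are the diagonal
entries of `Z`. -/
theorem cornerTrace_eq_sum {n k : ℕ} (h : k ≤ n) {Z : Matrix (Fin n) (Fin n) 𝕜}
    (hZ : (corner h Z).det ≠ 0) :
    cornerTrace h Z = ∑ l, if k ≤ l.val ∧ l.val < n - k then through h Z l else Z l l := by
  have h1 : (corner h Z)⁻¹ * corner h Z = 1 := Matrix.nonsing_inv_mul _ hZ.isUnit
  have h2 : corner h Z * (corner h Z)⁻¹ = 1 := Matrix.mul_nonsing_inv _ hZ.isUnit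
  have hsum : cornerTrace h Z = ∑ l, through h Z l := by
    simp only [cornerTrace, Matrix.trace, Matrix.diag_apply, Matrix.mul_apply, through]
    rw [Finset.sum_comm, Finset.sum_comm (s := Finset.univ (α := Fin n))]
    refine Finset.sum_congr rfl fun a _ => ?_
    rw [Finset.sum_comm (s := Finset.univ (α := Fin n))]
    refine Finset.sum_congr rfl fun b _ => ?_
    simp only [corner, Matrix.submatrix_apply, Matrix.mul_apply, Finset.mul_sum]
    exact Finset.sum_congr rfl fun l _ => by ring
  rw [hsum]
  refine Finset.sum_congr rfl fun l _ => ?_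
  by_cases hl : l.val < k
  · rw [if_neg (by omega)]
    obtain ⟨c, rfl⟩ : ∃ c, l = Fin.castLE h c := ⟨⟨l, hl⟩, rfl⟩
    have h3 : ∀ b, ∑ a, (corner h Z)⁻¹ b a * Z (botIdx h a) (Fin.castLE h c) =
        (1 : Matrix (Fin k) (Fin k) 𝕜) b c := fun b => by rw [← h1, Matrix.mul_apply]; rfl
    rw [through, Finset.sum_comm]
    simp_rw [mul_assoc, ← Finset.mul_sum, h3]
    simp [Matrix.one_apply]
  by_cases hl' : l.val < n - k
  · rw [if_pos (by omega)]
  · rw [if_neg (by omega)]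
    obtain ⟨c, rfl⟩ : ∃ c, l = botIdx h c :=
      ⟨⟨l - (n - k), by omega⟩, Fin.ext (by simp only [botIdx]; omega)⟩
    have h3 : ∀ a, ∑ b, Z (botIdx h c) (Fin.castLE h b) * (corner h Z)⁻¹ b a =
        (1 : Matrix (Fin k) (Fin k) 𝕜) c a := fun b => by rw [← h2, Matrix.mul_apply]; rfl
    rw [through]
    simp_rw [← Finset.sum_mul, h3]
    simp [Matrix.one_apply]

/-- The determinant of a bordered matrix by the Schur complement. -/
theorem det_bordered {k : ℕ} (u v : Fin k → 𝕜) {M : Matrix (Fin k) (Fin k) 𝕜} (hM : M.det ≠ 0) :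
    Matrix.det (Matrix.of (Fin.cons (Fin.snoc u 0) (fun a : Fin k => Fin.snoc (M a) (v a)) :
      Fin (k + 1) → Fin (k + 1) → 𝕜)) = (-1) ^ (k + 1) * M.det * (u ⬝ᵥ M⁻¹.mulVec v) := by
  -- The last column is `(-u w, 0)` plus the combination of the other columns with `w = M⁻¹ v`.
  set w := M⁻¹.mulVec v with hw
  have hMw : M.mulVec w = v := by
    rw [hw, Matrix.mulVec_mulVec, Matrix.mul_nonsing_inv _ hM.isUnit, Matrix.one_mulVec]
  set A : Matrix (Fin (k + 1)) (Fin (k + 1)) 𝕜 :=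
    Matrix.of (Fin.cons (Fin.snoc u (-(u ⬝ᵥ w))) (fun a : Fin k => Fin.snoc (M a) 0)) with hA
  have hup := Matrix.det_updateCol_sum A (Fin.last k) (Fin.snoc w 1)
  have hmat : (A.updateCol (Fin.last k) fun i => ∑ j, (Fin.snoc w 1 : Fin (k + 1) → 𝕜) j • A i j) =
      Matrix.of (Fin.cons (Fin.snoc u 0) (fun a : Fin k => Fin.snoc (M a) (v a)) :
        Fin (k + 1) → Fin (k + 1) → 𝕜) := by
    ext i j
    refine Fin.lastCases ?_ (fun b => ?_) j
    · rw [Matrix.updateCol_self, Fin.sum_univ_castSucc]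
      refine Fin.cases ?_ (fun a => ?_) i
      · simp [hA, dotProduct, mul_comm]
      · simp [hA, ← hMw, Matrix.mulVec, dotProduct, mul_comm]
    · rw [Matrix.updateCol_ne (Fin.castSucc_lt_last b).ne]
      refine Fin.cases ?_ (fun a => ?_) i <;> simp [hA]
  rw [hmat] at hup
  rw [hup, Matrix.det_succ_column A (Fin.last k), Fin.sum_univ_succ, Finset.sum_eq_zero]
  · have hs : A.submatrix (Fin.succAbove 0) (Fin.last k).succAbove = M := by
      ext a b
      simp [hA]
    rw [hs]
    simp [hA, pow_succ]
    ring
  · intro a _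
    simp [hA]

theorem bordered_ofLow {n k : ℕ} (h : k ≤ n) (c : 𝕜)
    {Z : Matrix (Fin n) (Fin n) 𝕜} (hZ : (corner h Z).det ≠ 0) (l : Fin n)
    (hl : k ≤ l.val ∧ l.val < n - k) :
    bordered k (l + 1) (ofLow c Z) =
      (-1) ^ (k + 1) * (corner h Z).det * through h Z l := by
  have hX : ∀ i j : Fin n, j < i → X (ofLow c Z) (i + 1) (j + 1) = Z i j := fun i j hij => by
    rw [X_eq_low, low_ofLow_of_lt _ _ hij]
  have hd := det_bordered (fun b => Z l (Fin.castLE h b)) (fun a => Z (botIdx h a) l) hZ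
  have hthr : through h Z l = (fun b => Z l (Fin.castLE h b)) ⬝ᵥ
      (corner h Z)⁻¹.mulVec (fun a => Z (botIdx h a) l) := by
    rw [through, Finset.sum_comm]
    simp only [dotProduct, Matrix.mulVec, Finset.mul_sum, mul_assoc]
  rw [hthr, ← hd, bordered]
  have e1 : ∀ a : Fin k, n - k + 1 + a.val = (botIdx h a).val + 1 := fun a => by
    simp only [botIdx]; omega
  congr 4
  · funext b
    exact hX l (Fin.castLE h b) (by rw [Fin.lt_def, Fin.val_castLE]; omega)
  · funext a
    congr 1
    · funext b
      rw [e1]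
      exact hX (botIdx h a) (Fin.castLE h b) (by
        rw [Fin.lt_def, Fin.val_castLE]; simp only [botIdx]; omega)
    · rw [e1]
      exact hX (botIdx h a) l (by rw [Fin.lt_def]; simp only [botIdx]; omega)

theorem sum_Ioo_eq_sum_fin {n k : ℕ} (f : ℕ → 𝕜) :
    ∑ i ∈ Finset.Ioo k (n - k + 1), f i =
      ∑ l : Fin n, if k ≤ l.val ∧ l.val < n - k then f (l + 1) else 0 := by
  rw [Fin.sum_univ_eq_sum_range (fun l => if k ≤ l ∧ l < n - k then f (l + 1) else 0),
    ← Finset.sum_filter]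
  refine Finset.sum_bij' (fun i _ => i - 1) (fun l _ => l + 1) ?_ ?_ ?_ ?_ ?_
  · intro i hi
    rw [Finset.mem_Ioo] at hi
    rw [Finset.mem_filter, Finset.mem_range]; omega
  · intro l hl
    rw [Finset.mem_filter, Finset.mem_range] at hl
    rw [Finset.mem_Ioo]; omega
  · intro i hi
    rw [Finset.mem_Ioo] at hi
    omega
  · intro l _
    omega
  · intro i hi
    rw [Finset.mem_Ioo] at hi
    rw [Nat.sub_add_cancel (by omega)]

/-- Abel summation of a tuple that is symmetric under `k ↦ n - k + 1`. -/
theorem sum_sub_eq {n : ℕ} {γ : ℕ → 𝕜} (hγ : ∀ k ∈ Finset.Icc 1 (n / 2), γ k = γ (n - k + 1))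
    {l : ℕ} (hl : l < n) :
    (∑ k ∈ Finset.Icc 1 (n / 2), if k ≤ l ∧ l < n - k then 0 else γ k - γ (k + 1)) =
      γ (l + 1) - γ (n / 2 + 1) := by
  have hr : γ (l + 1) = γ (min (l + 1) (n - l)) := by
    by_cases h1 : l + 1 ≤ n - l
    · rw [min_eq_left h1]
    · rw [min_eq_right (by omega), hγ (n - l) (by rw [Finset.mem_Icc]; omega)]
      congr 1; omega
  have hIcc : (Finset.Icc 1 (n / 2)).filter (fun k => ¬ (k ≤ l ∧ l < n - k)) =
      Finset.Ico (min (l + 1) (n - l)) (n / 2 + 1) := by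
    ext k
    simp only [Finset.mem_filter, Finset.mem_Icc, Finset.mem_Ico]
    omega
  have htel : ∀ a d : ℕ, ∑ k ∈ Finset.Ico a (a + d), (γ k - γ (k + 1)) = γ a - γ (a + d) :=
    fun a d => by
    rw [Finset.sum_Ico_eq_sum_range, Nat.add_sub_cancel_left]
    exact Finset.sum_range_sub' (fun i => γ (a + i)) d
  have h2 := htel (min (l + 1) (n - l)) (n / 2 + 1 - min (l + 1) (n - l))
  rw [Nat.add_sub_cancel' (by omega)] at h2
  rw [hr, ← h2, ← hIcc, Finset.sum_filter]
  exact Finset.sum_congr rfl fun k _ => (ite_not _ _ _).symm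

/-- In terms of the conjugation invariants `cornerTrace`, the last invariant of the singular case
at a point with the strictly lower part of `Z` is linear in the diagonal of `Z`. -/
theorem singInv_ofLow {n : ℕ} {γ : ℕ → 𝕜}
    (hγ : ∀ k ∈ Finset.Icc 1 (n / 2), γ k = γ (n - k + 1)) (c : 𝕜) (Z : Matrix (Fin n) (Fin n) 𝕜)
    (hZ : ∀ k (h : k ≤ n), k ∈ Finset.Icc 1 (n / 2) → γ k ≠ γ (k + 1) → (corner h Z).det ≠ 0) :
    singInv γ (ofLow c Z) = c + (∑ k : {k : ℕ // k ∈ Finset.Icc 1 (n / 2)},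
      (γ k - γ (k + 1)) * cornerTrace (k := k.val) (n := n)
        (by have := Finset.mem_Icc.1 k.2; omega) Z) -
      ((Gam n γ * Z).trace - γ (n / 2 + 1) * Z.trace) := by
  have hterm : ∀ k : {k : ℕ // k ∈ Finset.Icc 1 (n / 2)},
      (-1) ^ (k.val + 1) / minor k (ofLow c Z) * (γ k - γ (k + 1)) *
        ∑ i ∈ Finset.Ioo k.val (n - k + 1), bordered k i (ofLow c Z) =
      (γ k - γ (k + 1)) * cornerTrace (k := k.val) (n := n)
        (by have := Finset.mem_Icc.1 k.2; omega) Z -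
      ∑ l : Fin n, (if k.val ≤ l.val ∧ l.val < n - k then 0 else γ k - γ (k + 1)) * Z l l := by
    intro k
    have hk := Finset.mem_Icc.1 k.2
    have hn : k.val ≤ n := by omega
    by_cases he : γ k = γ (k + 1)
    · simp [he]
    have hd := hZ k hn k.2 he
    rw [cornerTrace_eq_sum hn hd, sum_Ioo_eq_sum_fin, minor_ofLow hn (by omega),
      Finset.mul_sum, Finset.mul_sum, ← Finset.sum_sub_distrib]
    refine Finset.sum_congr rfl fun l _ => ?_
    by_cases hl : k.val ≤ l.val ∧ l.val < n - k
    · simp only [if_pos hl]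
      rw [bordered_ofLow hn c hd l hl]
      have h1 : ((-1 : 𝕜) ^ (k.val + 1)) * (-1) ^ (k.val + 1) = 1 := by
        rw [← mul_pow]; simp
      field_simp
      linear_combination ((γ k - γ (k + 1)) * through hn Z l) * h1
    · simp only [if_neg hl]
      ring
  unfold singInv
  rw [← Finset.sum_coe_sort (Finset.Icc 1 (n / 2)), Finset.sum_congr rfl fun k _ => hterm k,
    Finset.sum_sub_distrib, Finset.sum_comm]
  simp_rw [← Finset.sum_mul]
  have hl : ∀ l : Fin n, (∑ k : {k : ℕ // k ∈ Finset.Icc 1 (n / 2)},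
      if k.val ≤ l.val ∧ l.val < n - k then 0 else γ k - γ (k + 1)) =
      γ (l + 1) - γ (n / 2 + 1) := fun l => by
    rw [← sum_sub_eq hγ l.2]
    exact Finset.sum_coe_sort (Finset.Icc 1 (n / 2))
      (fun k => if k ≤ l.val ∧ l.val < n - k then 0 else γ k - γ (k + 1))
  simp_rw [hl, sub_mul, Finset.sum_sub_distrib, ← Finset.mul_sum]
  have hG : (Gam n γ * Z).trace = ∑ l : Fin n, γ (l + 1) * Z l l := by
    simp [Gam, Matrix.trace, Matrix.diagonal_mul]
  rw [hG, Matrix.trace]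
  simp only [Matrix.diag_apply, ofLow]
  ring

/-- The invariance of the last expression of the singular case under the whole group. -/
theorem singInv_conj {n : ℕ} {γ : ℕ → 𝕜}
    (hγ : ∀ k ∈ Finset.Icc 1 (n / 2), γ k = γ (n - k + 1)) {x : Idx n → 𝕜}
    (hx : ∀ k ∈ Finset.Icc 1 (n / 2), γ k ≠ γ (k + 1) → minor k x ≠ 0)
    {B B' : Matrix (Fin n) (Fin n) 𝕜} (hB : B.BlockTriangular id) (hB' : B'.BlockTriangular id)
    (hBB' : B * B' = 1) :
    singInv γ (ofLow (x none + (Gam n γ * (B * low x * B')).trace) (B * low x * B')) =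
      singInv γ x := by
  have hne : ∀ i, B i i ≠ 0 ∧ B' i i ≠ 0 := fun i => by
    have h1 := diag_mul hB hB' i
    rw [hBB', Matrix.one_apply_eq] at h1
    exact ⟨left_ne_zero_of_mul (h1 ▸ one_ne_zero), right_ne_zero_of_mul (h1 ▸ one_ne_zero)⟩
  have hx' : ∀ k (h : k ≤ n), k ∈ Finset.Icc 1 (n / 2) → γ k ≠ γ (k + 1) →
      (corner h (low x)).det ≠ 0 := by
    intro k h hk he
    rw [← minor_eq_det_corner _ (by have := Finset.mem_Icc.1 hk; omega)]
    exact hx k hk he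
  have htr : (B * low x * B').trace = 0 := by
    rw [Matrix.trace_mul_cycle, mul_eq_one_comm.1 hBB', Matrix.one_mul, trace_low]
  rw [singInv_ofLow hγ]
  · conv_rhs => rw [← ofLow_low x, singInv_ofLow hγ _ _ hx']
    have hG : (Gam n γ * low x).trace = 0 := by
      simp [Gam, Matrix.trace, Matrix.diagonal_mul, low_apply_of_le]
    rw [htr, hG, trace_low]
    simp_rw [cornerTrace_conj _ hB hB' hBB']
    ring
  · intro k h hk he
    rw [corner_mul_mul _ hB hB', Matrix.det_mul, Matrix.det_mul,
      det_submatrix_triangular hB (botIdx_strictMono _),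
      det_submatrix_triangular hB' (castLE_strictMono _)]
    exact mul_ne_zero (mul_ne_zero (Finset.prod_ne_zero_iff.2 fun a _ => (hne _).1)
      (hx' k h hk he)) (Finset.prod_ne_zero_iff.2 fun a _ => (hne _).2)

/-! ### Covectors that annihilate the tangent spaces of the orbits -/

/-- The velocity at `x` of the coadjoint action in the direction of a matrix `Z`. -/
def tvec {n : ℕ} (γ : ℕ → 𝕜) (x : Idx n → 𝕜) : Matrix (Fin n) (Fin n) 𝕜 →ₗ[𝕜] (Idx n → 𝕜) where
  toFun Z := ofLow (Gam n γ * (Z * low x - low x * Z)).trace (Z * low x - low x * Z)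
  map_add' Z Z' := by
    have h : (Z + Z') * low x - low x * (Z + Z') =
        (Z * low x - low x * Z) + (Z' * low x - low x * Z') := by
      rw [add_mul, mul_add]; abel
    rw [h]
    funext p
    rcases p with _ | p
    · simp only [ofLow, Pi.add_apply, mul_add, Matrix.trace_add]
    · rfl
  map_smul' c Z := by
    have h : (c • Z) * low x - low x * (c • Z) = c • (Z * low x - low x * Z) := by
      rw [smul_mul_assoc, mul_smul_comm, smul_sub]
    rw [h]
    funext p
    rcases p with _ | p
    · simp [ofLow, Matrix.trace_smul]
    · rfl

theorem tvec_apply {n : ℕ} (γ : ℕ → 𝕜) (x : Idx n → 𝕜) (Z : Matrix (Fin n) (Fin n) 𝕜) :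
    tvec γ x Z = ofLow (Gam n γ * (Z * low x - low x * Z)).trace (Z * low x - low x * Z) := rfl

theorem map_tvec_eq_zero {n : ℕ} {γ : ℕ → 𝕜} {x : Idx n → 𝕜} {φ : Module.Dual 𝕜 (Idx n → 𝕜)}
    (hφ : ∀ i j, i < j → φ (tvec γ x (Matrix.single i j 1)) = 0) {Z : Matrix (Fin n) (Fin n) 𝕜}
    (hZ : ∀ i j, j ≤ i → Z i j = 0) : φ (tvec γ x Z) = 0 := by
  rw [Matrix.matrix_eq_sum_single Z]
  simp only [map_sum]
  refine Finset.sum_eq_zero fun i _ => Finset.sum_eq_zero fun j _ => ?_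
  rcases lt_or_ge i j with h | h
  · have : Matrix.single i j (Z i j) = Z i j • Matrix.single i j (1 : 𝕜) := by simp
    rw [this, map_smul, map_smul, hφ i j h, smul_zero]
  · rw [hZ i j h, Matrix.single_zero, map_zero, map_zero]

/-- If `[L, Y]` vanishes below the diagonal and the last `k` rows of `Y` vanish, then the part of a
column of `Y` in the first `k` rows vanishes with the rest of the column. -/
theorem col_eq_zero {n k : ℕ} (h : k ≤ n) {L Y : Matrix (Fin n) (Fin n) 𝕜}
    (hL : (corner h L).det ≠ 0) (hLY : ∀ i j, j < i → (L * Y) i j = (Y * L) i j)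
    (hrow : ∀ i l : Fin n, n - k ≤ i.val → Y i l = 0) {j : Fin n} (hj : j.val < n - k)
    (hcol : ∀ l : Fin n, k ≤ l.val → Y l j = 0) (l : Fin n) : Y l j = 0 := by
  have hy : (corner h L).mulVec (fun b => Y (Fin.castLE h b) j) = 0 := by
    funext a
    have h1 := hLY (botIdx h a) j (by rw [Fin.lt_def]; simp only [botIdx]; omega)
    rw [Matrix.mul_apply, Matrix.mul_apply, sum_eq_sum_castLE h _ fun l hl => by
      rw [hcol l hl, mul_zero], Finset.sum_eq_zero (f := fun l => Y (botIdx h a) l * _)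
      fun l _ => by rw [hrow _ _ (by simp only [botIdx]; omega), zero_mul]] at h1
    exact h1
  have h2 := Matrix.eq_zero_of_mulVec_eq_zero hL hy
  by_cases hl : l.val < k
  · exact congrFun h2 ⟨l, hl⟩
  · exact hcol l (not_lt.1 hl)

/-- The transposed form of `col_eq_zero`, for the first `k` columns and the last `k` entries of a
row. -/
theorem row_eq_zero {n k : ℕ} (h : k ≤ n) {L Y : Matrix (Fin n) (Fin n) 𝕜}
    (hL : (corner h L).det ≠ 0) (hLY : ∀ i j, j < i → (L * Y) i j = (Y * L) i j)
    (hcol : ∀ l j : Fin n, j.val < k → Y l j = 0) {i : Fin n} (hi : k ≤ i.val)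
    (hrow : ∀ l : Fin n, l.val < n - k → Y i l = 0) (l : Fin n) : Y i l = 0 := by
  have hy : Matrix.vecMul (fun a => Y i (botIdx h a)) (corner h L) = 0 := by
    funext b
    have h1 := hLY i (Fin.castLE h b) (by rw [Fin.lt_def, Fin.val_castLE]; omega)
    rw [Matrix.mul_apply, Matrix.mul_apply, sum_eq_sum_botIdx h (fun l => Y i l * _) fun l hl => by
      rw [hrow l hl, zero_mul], Finset.sum_eq_zero (f := fun l => L i l * _)
      fun l _ => by rw [hcol _ _ (by rw [Fin.val_castLE]; omega), mul_zero]] at h1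
    exact h1.symm
  have h2 := Matrix.eq_zero_of_vecMul_eq_zero hL hy
  by_cases hl : l.val < n - k
  · exact hrow l hl
  · have h3 : botIdx h ⟨l - (n - k), by omega⟩ = l := Fin.ext (by simp only [botIdx]; omega)
    rw [← h3]
    exact congrFun h2 _

/-- A strictly upper triangular matrix in the stabilizer of a generic point is determined by its
entries on the antidiagonal. -/
theorem eq_zero_of_antidiagonal {n : ℕ} {L Y : Matrix (Fin n) (Fin n) 𝕜}
    (hL : ∀ k (h : k ≤ n), 2 * k ≤ n → (corner h L).det ≠ 0)
    (hY : ∀ i j, j ≤ i → Y i j = 0) (hLY : ∀ i j, j < i → (L * Y) i j = (Y * L) i j)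
    (hanti : ∀ i j : Fin n, i < j → i.val + j.val + 1 = n → Y i j = 0) : Y = 0 := by
  -- First the diagonal blocks: the first half of the columns and the second half of the rows.
  have hup : ∀ k, 2 * k ≤ n + 1 → (∀ l j : Fin n, j.val < k → Y l j = 0) ∧
      ∀ i l : Fin n, n - k ≤ i.val → Y i l = 0 := by
    intro k
    induction k with
    | zero => exact fun _ => ⟨fun l j hj => absurd hj (Nat.not_lt_zero _),
        fun i l hi => absurd i.2 (by omega)⟩
    | succ k ih =>
      intro hk
      obtain ⟨hc, hr⟩ := ih (by omega)
      have hd := hL k (by omega) (by omega)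
      constructor
      · intro l j hj
        rcases Nat.lt_succ_iff_lt_or_eq.1 hj with hj | hj
        · exact hc l j hj
        · exact col_eq_zero (by omega) hd hLY hr (by omega)
            (fun l hl => hY l j (by rw [Fin.le_def]; omega)) l
      · intro i l hi
        by_cases hi' : n - k ≤ i.val
        · exact hr i l hi'
        · exact row_eq_zero (by omega) hd hLY hc (by omega)
            (fun l hl => hY i l (by rw [Fin.le_def]; omega)) l
  -- Then outwards from the centre of the upper right block.
  have hdown : ∀ d, d ≤ n / 2 → (∀ l j : Fin n, j.val < n - (n / 2 - d) → Y l j = 0) ∧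
      ∀ i l : Fin n, n / 2 - d ≤ i.val → Y i l = 0 := by
    intro d
    induction d with
    | zero =>
      intro _
      obtain ⟨hc, hr⟩ := hup ((n + 1) / 2) (by omega)
      exact ⟨fun l j hj => hc l j (by omega), fun i l hi => hr i l (by omega)⟩
    | succ d ih =>
      intro hd
      obtain ⟨hc, hr⟩ := ih (by omega)
      set k := n / 2 - (d + 1) with hk
      have hdet := hL k (by omega) (by omega)
      constructor
      · intro l j hj
        by_cases hj' : j.val < n - (n / 2 - d)
        · exact hc l j hj'
        · refine col_eq_zero (by omega) hdet hLY (fun i l hi => hr i l (by omega)) hj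
            (fun l hl => ?_) l
          by_cases hl' : n / 2 - d ≤ l.val
          · exact hr l j hl'
          · exact hanti l j (by rw [Fin.lt_def]; omega) (by omega)
      · intro i l hi
        by_cases hi' : n / 2 - d ≤ i.val
        · exact hr i l hi'
        · refine row_eq_zero (by omega) hdet hLY (fun l j hj => hc l j (by omega)) hi
            (fun l hl => ?_) l
          by_cases hl' : l.val < n - (n / 2 - d)
          · exact hc i l hl'
          · exact hanti i l (by rw [Fin.lt_def]; omega) (by omega)
  ext l j
  exact (hdown (n / 2) le_rfl).1 l j (by have := j.2; omega)

/-- The coefficients of a covector at the coordinates `x_{ji}`, `i < j`, as a strictly upper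
triangular matrix. -/
def coeffMat {n : ℕ} (φ : Module.Dual 𝕜 (Idx n → 𝕜)) : Matrix (Fin n) (Fin n) 𝕜 :=
  Matrix.of fun i j => if h : i < j then φ (Pi.single (some ⟨(i, j), h⟩) 1) else 0

theorem coeffMat_of_lt {n : ℕ} (φ : Module.Dual 𝕜 (Idx n → 𝕜)) {i j : Fin n} (h : i < j) :
    coeffMat φ i j = φ (Pi.single (some ⟨(i, j), h⟩) 1) := by simp [coeffMat, h]

theorem coeffMat_of_le {n : ℕ} (φ : Module.Dual 𝕜 (Idx n → 𝕜)) {i j : Fin n} (h : j ≤ i) :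
    coeffMat φ i j = 0 := by simp [coeffMat, not_lt.2 h]

theorem dual_ofLow {n : ℕ} (φ : Module.Dual 𝕜 (Idx n → 𝕜)) (c : 𝕜)
    (Z : Matrix (Fin n) (Fin n) 𝕜) :
    φ (ofLow c Z) = c * φ (Pi.single none 1) + (coeffMat φ * Z).trace := by
  have h : (coeffMat φ * Z).trace = ∑ p : {p : Fin n × Fin n // p.1 < p.2},
      coeffMat φ p.val.1 p.val.2 * Z p.val.2 p.val.1 := by
    simp only [Matrix.trace, Matrix.diag_apply, Matrix.mul_apply]
    exact sum_eq_sum_pairs (fun i j => coeffMat φ i j * Z j i) fun i j hij => by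
      rw [coeffMat_of_le _ (not_lt.1 hij), zero_mul]
  rw [h]
  conv_lhs => rw [LinearMap.pi_apply_eq_sum_univ φ (ofLow c Z), Fintype.sum_option]
  have hs : ∀ q : Idx n, (fun j => if q = j then (1 : 𝕜) else 0) = Pi.single q 1 := fun q => by
    funext j
    rw [Pi.single_apply]
    simp only [eq_comm]
  simp only [hs, smul_eq_mul]
  congr 1
  exact Finset.sum_congr rfl fun p _ => by rw [coeffMat_of_lt _ p.2, mul_comm]; rfl

/-- A covector at a generic point that annihilates `∂/∂x₀` and the tangent space of the orbit of
the unipotent group is determined by its values on the antidiagonal. -/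
theorem dual_eq_zero {n : ℕ} {γ : ℕ → 𝕜} {x : Idx n → 𝕜}
    (hx : ∀ k ∈ Finset.Icc 1 (n / 2), minor k x ≠ 0) {φ : Module.Dual 𝕜 (Idx n → 𝕜)}
    (h0 : φ (Pi.single none 1) = 0)
    (hφ : ∀ i j, i < j → φ (tvec γ x (Matrix.single i j 1)) = 0)
    (hanti : ∀ k (h : 2 * (k + 1) ≤ n), φ (Pi.single (antiIdx h) 1) = 0) : φ = 0 := by
  have hY : coeffMat φ = 0 := by
    refine eq_zero_of_antidiagonal (L := low x) ?_ (fun i j => coeffMat_of_le φ) ?_ ?_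
    · intro k h hk
      rcases Nat.eq_zero_or_pos k with rfl | hk0
      · rw [Matrix.det_fin_zero]; exact one_ne_zero
      · rw [← minor_eq_det_corner h hk]
        exact hx k (by rw [Finset.mem_Icc]; omega)
    · intro i j hij
      have h1 := hφ j i hij
      rw [tvec_apply, dual_ofLow, h0, mul_zero, zero_add, mul_sub, Matrix.trace_sub,
        ← Matrix.mul_assoc, ← Matrix.mul_assoc, Matrix.trace_mul_cycle, Matrix.trace_mul_single,
        Matrix.trace_mul_single, sub_eq_zero] at h1
      simpa using h1
    · intro i j hij hn
      have hi : 2 * (i.val + 1) ≤ n := by rw [Fin.lt_def] at hij; omega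
      rw [coeffMat_of_lt φ hij, ← hanti i hi]
      have he : (some ⟨(i, j), hij⟩ : Idx n) = antiIdx hi :=
        congrArg some (Subtype.ext (Prod.ext rfl (Fin.ext (by simp only; omega))))
      rw [he]
  refine LinearMap.ext fun v => ?_
  rw [← ofLow_low v, dual_ofLow, h0, hY, mul_zero, Matrix.zero_mul, Matrix.trace_zero, add_zero,
    LinearMap.zero_apply]

/-- The exponent `∑_{i ≤ k} (γ_{n-i+1} - γ_i)` with which the torus acts on the corner minor of
order `k`. -/
def weight (n : ℕ) (γ : ℕ → 𝕜) (k : ℕ) : 𝕜 := ∑ i ∈ Finset.Icc 1 k, (γ (n - i + 1) - γ i)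

theorem weight_eq {n k : ℕ} (h : k ≤ n) (γ : ℕ → 𝕜) :
    weight n γ k = ∑ a, γ (botIdx h a + 1) - ∑ b, γ (Fin.castLE h b + 1) := by
  have hIcc : ∀ f : ℕ → 𝕜, ∑ i ∈ Finset.Icc 1 k, f i = ∑ i ∈ Finset.range k, f (i + 1) :=
    fun f => by
    rw [Finset.range_eq_Ico, Finset.sum_Ico_add' f 0 k 1, zero_add,
      Finset.Ico_add_one_right_eq_Icc]
  rw [weight, Finset.sum_sub_distrib]
  congr 1
  · simp only [botIdx]
    rw [hIcc, Fin.sum_univ_eq_sum_range (fun a => γ (n - k + a + 1)) k,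
      ← Finset.sum_range_reflect]
    refine Finset.sum_congr rfl fun i hi => ?_
    have := Finset.mem_range.1 hi
    congr 1
    omega
  · rw [hIcc]
    exact (Fin.sum_univ_eq_sum_range (fun b => γ (b + 1)) k).symm

/-- In a direction with non-zero weight `∂/∂x₀` is tangent to the orbit of the unipotent group: it
is up to a factor the velocity of `M⁻¹`, placed in the upper right corner. -/
theorem weight_mul_eq_zero {n k : ℕ} (h : k ≤ n) (hk : 2 * k ≤ n) {γ : ℕ → 𝕜} {x : Idx n → 𝕜}
    (hx : minor k x ≠ 0) {φ : Module.Dual 𝕜 (Idx n → 𝕜)}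
    (hφ : ∀ i j, i < j → φ (tvec γ x (Matrix.single i j 1)) = 0) :
    weight n γ k * φ (Pi.single none 1) = 0 := by
  set M := corner h (low x) with hM
  have hd : M.det ≠ 0 := by rwa [hM, ← minor_eq_det_corner h hk]
  have h1 : M⁻¹ * M = 1 := Matrix.nonsing_inv_mul _ hd.isUnit
  have h2 : M * M⁻¹ = 1 := Matrix.mul_nonsing_inv _ hd.isUnit
  set Z : Matrix (Fin n) (Fin n) 𝕜 := Matrix.of fun i j =>
    if hij : i.val < k ∧ n - k ≤ j.val then M⁻¹ ⟨i, hij.1⟩ ⟨j - (n - k), by omega⟩ else 0 with hZ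
  have hZ1 : ∀ i j : Fin n, ¬ (i.val < k ∧ n - k ≤ j.val) → Z i j = 0 := fun i j hij => by
    simp only [hZ, Matrix.of_apply, dif_neg hij]
  have hZ2 : ∀ b a, Z (Fin.castLE h b) (botIdx h a) = M⁻¹ b a := fun b a => by
    have hab : (Fin.castLE h b).val < k ∧ n - k ≤ (botIdx h a).val :=
      ⟨b.2, Nat.le_add_right _ _⟩
    have ha : (⟨(botIdx h a).val - (n - k), by have := (botIdx h a).2; omega⟩ : Fin k) = a :=
      Fin.ext (Nat.add_sub_cancel_left _ _)
    simp only [hZ, Matrix.of_apply, dif_pos hab, ha]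
    rfl
  have hZL : ∀ b c, (Z * low x) (Fin.castLE h b) (Fin.castLE h c) =
      (1 : Matrix (Fin k) (Fin k) 𝕜) b c := fun b c => by
    rw [← h1, Matrix.mul_apply, Matrix.mul_apply, sum_eq_sum_botIdx h _ fun l hl => by
      rw [hZ1 _ _ (by omega), zero_mul]]
    exact Finset.sum_congr rfl fun a _ => by rw [hZ2]; rfl
  have hLZ : ∀ a c, (low x * Z) (botIdx h a) (botIdx h c) =
      (1 : Matrix (Fin k) (Fin k) 𝕜) a c := fun a c => by
    rw [← h2, Matrix.mul_apply, Matrix.mul_apply, sum_eq_sum_castLE h _ fun l hl => by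
      rw [hZ1 _ _ (by omega), mul_zero]]
    exact Finset.sum_congr rfl fun b _ => by rw [hZ2]; rfl
  have hZL0 : ∀ i j : Fin n, k ≤ i.val → (Z * low x) i j = 0 := fun i j hi => by
    rw [Matrix.mul_apply]
    exact Finset.sum_eq_zero fun l _ => by rw [hZ1 _ _ (by omega), zero_mul]
  have hLZ0 : ∀ i j : Fin n, j.val < n - k → (low x * Z) i j = 0 := fun i j hj => by
    rw [Matrix.mul_apply]
    exact Finset.sum_eq_zero fun l _ => by rw [hZ1 _ _ (by omega), mul_zero]
  have hbot : ∀ i : Fin n, n - k ≤ i.val → ∃ a, i = botIdx h a := fun i hi =>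
    ⟨⟨i - (n - k), by omega⟩, Fin.ext (by simp only [botIdx]; omega)⟩
  have hlow : ∀ i j, j < i → (Z * low x - low x * Z) i j = 0 := by
    intro i j hij
    have hij' := Fin.lt_def.1 hij
    rw [Matrix.sub_apply]
    by_cases hi : i.val < k
    · rw [hLZ0 i j (by omega), sub_zero]
      have h3 := hZL ⟨i, hi⟩ ⟨j, by omega⟩
      rw [Matrix.one_apply_ne (by simp only [ne_eq, Fin.mk.injEq]; omega)] at h3
      exact h3
    · rw [hZL0 i j (by omega), zero_sub, neg_eq_zero]
      by_cases hj : j.val < n - k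
      · exact hLZ0 i j hj
      · obtain ⟨a, rfl⟩ := hbot i (by omega)
        obtain ⟨c, rfl⟩ := hbot j (by omega)
        rw [hLZ, Matrix.one_apply_ne]
        rintro rfl
        exact lt_irrefl _ hij
  have htr : (Gam n γ * (Z * low x - low x * Z)).trace = -weight n γ k := by
    rw [weight_eq h]
    simp only [Gam, Matrix.trace, Matrix.diagonal_mul, Matrix.diag_apply, Matrix.sub_apply,
      mul_sub, Finset.sum_sub_distrib]
    rw [sum_eq_sum_castLE h (fun i => γ (i + 1) * (Z * low x) i i) fun l hl => by
        rw [hZL0 l l hl, mul_zero],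
      sum_eq_sum_botIdx h (fun i => γ (i + 1) * (low x * Z) i i) fun l hl => by
        rw [hLZ0 l l hl, mul_zero]]
    simp only [hZL, hLZ, Matrix.one_apply_eq, mul_one]
    ring
  have h3 := map_tvec_eq_zero hφ (Z := Z) fun i j hij => hZ1 i j (by
    rw [Fin.le_def] at hij; omega)
  have h4 : (coeffMat φ * (Z * low x - low x * Z)).trace = 0 := by
    simp only [Matrix.trace, Matrix.diag_apply, Matrix.mul_apply]
    refine Finset.sum_eq_zero fun i _ => Finset.sum_eq_zero fun j _ => ?_
    rcases lt_or_ge i j with hij | hij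
    · rw [hlow j i hij, mul_zero]
    · rw [coeffMat_of_le φ hij, zero_mul]
  rw [tvec_apply, dual_ofLow, htr, h4, add_zero, neg_mul, neg_eq_zero] at h3
  exact h3

/-! ### Functional dependence -/

theorem surjective_pi_of_linearIndependent {E : Type*} [AddCommGroup E] [Module 𝕜 E]
    {ι : Type*} [Fintype ι] {f : ι → Module.Dual 𝕜 E} (hf : LinearIndependent 𝕜 f) :
    Function.Surjective (LinearMap.pi f) := by
  classical
  rw [← LinearMap.range_eq_top]
  by_contra hne
  obtain ⟨g, hg0, hg⟩ := Submodule.exists_le_ker_of_lt_top _ (lt_top_iff_ne_top.2 hne)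
  refine hg0 ?_
  have hsum : ∑ l, g (Pi.single l 1) • f l = 0 := by
    refine LinearMap.ext fun v => ?_
    have h1 : g (LinearMap.pi f v) = 0 := hg ⟨v, rfl⟩
    rw [LinearMap.pi_apply_eq_sum_univ g] at h1
    have hs : ∀ q : ι, (fun j => if q = j then (1 : 𝕜) else 0) = Pi.single q 1 := fun q => by
      funext j
      rw [Pi.single_apply]
      simp only [eq_comm]
    simp only [hs, LinearMap.pi_apply, smul_eq_mul] at h1
    simp only [LinearMap.sum_apply, LinearMap.smul_apply, LinearMap.zero_apply, smul_eq_mul]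
    rw [← h1]
    exact Finset.sum_congr rfl fun _ _ => mul_comm _ _
  have hz := Fintype.linearIndependent_iff.1 hf _ hsum
  refine LinearMap.pi_ext fun i c => ?_
  have : Pi.single i c = c • Pi.single i (1 : 𝕜) := by
    rw [← Pi.single_smul, smul_eq_mul, mul_one]
  rw [this, map_smul, hz i, smul_zero, LinearMap.zero_apply]

/-- If the differential of `H` is at every point a combination of the differentials of the `F l`,
which are linearly independent at `x`, then near `x` the function `H` is a smooth function of the
`F l`: complete the `F l` to coordinates, in which `H` does not depend on the added ones. -/
theorem exists_eventuallyEq_comp {E : Type*} [NormedAddCommGroup E] [NormedSpace 𝕜 E]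
    [FiniteDimensional 𝕜 E] {ι : Type*} [Fintype ι] {F : ι → E → 𝕜} {H : E → 𝕜} {O : Set E}
    (hO : IsOpen O) (hF : ∀ l, ContDiffOn 𝕜 ∞ (F l) O) (hH : ContDiffOn 𝕜 ∞ H O)
    (hspan : ∀ y ∈ O, ∃ a : ι → 𝕜, fderiv 𝕜 H y = ∑ l, a l • fderiv 𝕜 (F l) y)
    {x : E} (hx : x ∈ O) (hli : LinearIndependent 𝕜 fun l => fderiv 𝕜 (F l) x) :
    ∃ Φ : (ι → 𝕜) → 𝕜, ContDiffAt 𝕜 ∞ Φ (fun l => F l x) ∧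
      ∀ᶠ y in nhds x, H y = Φ fun l => F l y := by
  classical
  have : CompleteSpace E := FiniteDimensional.complete 𝕜 E
  have hFd : ∀ l, ∀ y ∈ O, HasFDerivAt (F l) (fderiv 𝕜 (F l) y) y := fun l y hy =>
    (((hF l).contDiffAt (hO.mem_nhds hy)).differentiableAt (by simp)).hasFDerivAt
  have hHd : ∀ y ∈ O, HasFDerivAt H (fderiv 𝕜 H y) y := fun y hy =>
    ((hH.contDiffAt (hO.mem_nhds hy)).differentiableAt (by simp)).hasFDerivAt
  set F' : E →L[𝕜] (ι → 𝕜) := ContinuousLinearMap.pi fun l => fderiv 𝕜 (F l) x with hF'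
  have hsurj : Function.Surjective F' := by
    have hli' : LinearIndependent 𝕜 fun l => (fderiv 𝕜 (F l) x : E →ₗ[𝕜] 𝕜) :=
      hli.map' (ContinuousLinearMap.coeLM 𝕜)
        (LinearMap.ker_eq_bot.2 ContinuousLinearMap.coe_injective)
    exact surjective_pi_of_linearIndependent hli'
  let K : Submodule 𝕜 E := LinearMap.ker (F' : E →ₗ[𝕜] (ι → 𝕜))
  obtain ⟨q₀, hq₀⟩ := LinearMap.exists_leftInverse_of_injective K.subtype
    (LinearMap.ker_eq_bot.2 K.injective_subtype)
  set q : E →L[𝕜] K := LinearMap.toContinuousLinearMap q₀ with hq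
  have hqK : ∀ v : K, q v = v := fun v => LinearMap.congr_fun hq₀ v
  have hbij : Function.Bijective (F'.prod q) := by
    constructor
    · rw [injective_iff_map_eq_zero]
      intro v hv
      rw [ContinuousLinearMap.prod_apply, Prod.mk_eq_zero] at hv
      have h1 : q v = ⟨v, hv.1⟩ := hqK ⟨v, hv.1⟩
      exact (congrArg Subtype.val (hv.2.symm.trans h1)).symm
    · rintro ⟨u, w⟩
      obtain ⟨v, hv⟩ := hsurj u
      refine ⟨v + ((w - q v : K) : E), ?_⟩
      have h2 : F' ((w - q v : K) : E) = 0 := (w - q v).2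
      rw [ContinuousLinearMap.prod_apply, map_add, map_add, hqK, h2, hv, add_zero,
        add_sub_cancel]
  let A : E ≃L[𝕜] (ι → 𝕜) × K :=
    (LinearEquiv.ofBijective (F'.prod q : E →ₗ[𝕜] (ι → 𝕜) × K) hbij).toContinuousLinearEquiv
  set G : E → (ι → 𝕜) × K := fun y => (fun l => F l y, q y) with hG
  have hGd : HasFDerivAt G (A : E →L[𝕜] (ι → 𝕜) × K) x := by
    have h1 : HasFDerivAt G (F'.prod q) x :=
      (hasFDerivAt_pi.2 fun l => hFd l x hx).prodMk q.hasFDerivAt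
    exact h1
  have hGc : ContDiffAt 𝕜 ∞ G x :=
    (contDiffAt_pi.2 fun l => (hF l).contDiffAt (hO.mem_nhds hx)).prodMk q.contDiff.contDiffAt
  set g := hGc.localInverse hGd (by simp) with hg
  have hgx : g (G x) = x := hGc.localInverse_apply_image hGd _
  have hgc : ContDiffAt 𝕜 ∞ g (G x) := hGc.to_localInverse hGd _
  have hright : ∀ᶠ z in nhds (G x), G (g z) = z :=
    (hGc.hasStrictFDerivAt' hGd (by simp)).eventually_right_inverse
  have hleft : ∀ᶠ y in nhds x, g (G y) = y :=
    (hGc.hasStrictFDerivAt' hGd (by simp)).eventually_left_inverse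
  have hgO : ∀ᶠ z in nhds (G x), g z ∈ O :=
    hgc.continuousAt.eventually_mem (by rw [hgx]; exact hO.mem_nhds hx)
  have hgdiff : ∀ᶠ z in nhds (G x), DifferentiableAt 𝕜 g z :=
    ((hgc.of_le (m := 1) (by exact_mod_cast le_top)).eventually (by decide)).mono
      fun z hz => hz.differentiableAt (by simp)
  obtain ⟨r, hr, hball⟩ := Metric.eventually_nhds_iff_ball.1
    ((hright.eventually_nhds.and hgO).and hgdiff)
  set u₀ : ι → 𝕜 := fun l => F l x with hu₀
  have hGx : G x = (u₀, q x) := rfl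
  rw [hGx, ← ball_prod_same] at hball
  -- In the coordinates `(u, w)` the derivative of `H` along `w` vanishes.
  have hconst : ∀ u ∈ Metric.ball u₀ r, ∀ w ∈ Metric.ball (q x) r,
      H (g (u, w)) = H (g (u, q x)) := by
    intro u hu w hw
    let _ : NormedSpace ℝ K := NormedSpace.restrictScalars ℝ 𝕜 K
    have hder : ∀ w ∈ Metric.ball (q x) r,
        HasFDerivAt (fun w => H (g (u, w))) (0 : K →L[𝕜] 𝕜) w := by
      intro w hw
      obtain ⟨⟨h1, h2⟩, h3⟩ := hball (u, w) ⟨hu, hw⟩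
      have hcomp := (hHd _ h2).comp w (h3.hasFDerivAt.comp w (hasFDerivAt_prodMk_right u w))
      refine hcomp.congr_fderiv (ContinuousLinearMap.ext fun v => ?_)
      obtain ⟨a, ha⟩ := hspan _ h2
      have hl : ∀ l, fderiv 𝕜 (F l) (g (u, w)) (fderiv 𝕜 g (u, w) (0, v)) = 0 := by
        intro l
        have h4 : HasFDerivAt (fun z : (ι → 𝕜) × K => F l (g z))
            ((fderiv 𝕜 (F l) (g (u, w))).comp (fderiv 𝕜 g (u, w))) (u, w) :=
          (hFd l _ h2).comp (u, w) h3.hasFDerivAt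
        have h5 : HasFDerivAt (fun z : (ι → 𝕜) × K => F l (g z))
            ((ContinuousLinearMap.proj l).comp (ContinuousLinearMap.fst 𝕜 (ι → 𝕜) K)) (u, w) := by
          refine ((ContinuousLinearMap.proj (R := 𝕜) l).comp
            (ContinuousLinearMap.fst 𝕜 (ι → 𝕜) K)).hasFDerivAt.congr_of_eventuallyEq ?_
          filter_upwards [h1] with z hz
          exact congrFun (congrArg Prod.fst hz) l
        have h6 := DFunLike.congr_fun (h4.unique h5) (0, v)
        simpa using h6
      simp [ha, hl]
    exact Metric.isOpen_ball.is_const_of_fderiv_eq_zero (𝕜 := 𝕜)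
      (convex_ball (q x) r).isPreconnected
      (fun w hw => (hder w hw).differentiableAt.differentiableWithinAt)
      (fun w hw => (hder w hw).fderiv) hw (Metric.mem_ball_self hr)
  refine ⟨fun u => H (g (u, q x)), ?_, ?_⟩
  · have h1 : ContDiffAt 𝕜 ∞ (fun u : ι → 𝕜 => g (u, q x)) u₀ :=
      ContDiffAt.comp u₀ (g := g) hgc (contDiffAt_id.prodMk contDiffAt_const)
    refine ContDiffAt.comp u₀ (g := H) ?_ h1
    change ContDiffAt 𝕜 ∞ H (g (G x))
    rw [hgx]
    exact hH.contDiffAt (hO.mem_nhds hx)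
  · filter_upwards [hleft, hGc.continuousAt.eventually_mem (Metric.ball_mem_nhds (G x) hr)]
      with y hy hyb
    rw [hGx, ← ball_prod_same] at hyb
    rw [← hconst _ hyb.1 _ hyb.2]
    exact congrArg H hy.symm

/-! ### Determinations of the power function -/

/-- A continuous solution `p` of `f ∘ p = h` is differentiable where `f' ≠ 0`. -/
theorem hasDerivAt_of_comp_eq {f h p : 𝕜 → 𝕜} {f' h' z : 𝕜} (hp : ContinuousAt p z)
    (hf : HasStrictDerivAt f f' (p z)) (hf0 : f' ≠ 0) (hh : HasDerivAt h h' z)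
    (heq : ∀ᶠ w in nhds z, f (p w) = h w) : HasDerivAt p (f'⁻¹ * h') z := by
  have h1 := (hf.to_localInverse hf0).hasDerivAt
  rw [heq.self_of_nhds] at h1
  refine (h1.comp z hh).congr_of_eventuallyEq ?_
  filter_upwards [heq, hp.eventually (hf.eventually_left_inverse hf0)] with w hw1 hw2
  rw [Function.comp_apply, ← hw1, hw2]

theorem exp_ne_zero (z : 𝕜) : NormedSpace.exp z ≠ 0 := fun h => by
  have h1 := NormedSpace.exp_add (x := z) (y := -z)
  rw [h, zero_mul, add_neg_cancel, NormedSpace.exp_zero] at h1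
  exact one_ne_zero h1

/-- A function `exp(α l)` with a continuous solution `l` of `exp(l z) = c z` satisfies the
differential equation of the power function. -/
theorem hasDerivAt_exp_mul {α c z : 𝕜} {l p : 𝕜 → 𝕜} (hz : z ≠ 0) (hc : c ≠ 0)
    (hl : ContinuousAt l z) (hexp : ∀ᶠ w in nhds z, NormedSpace.exp (l w) = c * w)
    (hp : ∀ᶠ w in nhds z, p w = NormedSpace.exp (α * l w)) :
    p z ≠ 0 ∧ HasDerivAt p (α * p z / z) z := by
  have h1 := hasDerivAt_of_comp_eq hl hasStrictDerivAt_exp (exp_ne_zero _)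
    ((hasDerivAt_id z).const_mul c) hexp
  rw [hexp.self_of_nhds] at h1
  have h2 := (hasDerivAt_exp (x := α * l z)).comp z (h1.const_mul α)
  refine ⟨by rw [hp.self_of_nhds]; exact exp_ne_zero _, ?_⟩
  rw [hp.self_of_nhds]
  refine (h2.congr_of_eventuallyEq hp).congr_deriv ?_
  field_simp

theorem exp_ofReal (r : ℝ) : NormedSpace.exp (r : 𝕜) = (Real.exp r : 𝕜) := by
  rw [Real.exp_eq_exp_ℝ]
  exact (NormedSpace.algebraMap_exp_comm (𝔸 := 𝕜) r).symm

/-- Every determination of the power function has no zeros and solves `p' = α p / z`. -/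
theorem IsPowerOn.hasDerivAt {α : 𝕜} {V : Set 𝕜} {p : 𝕜 → 𝕜} (hV : IsOpen V)
    (h : IsPowerOn α V p) {z : 𝕜} (hz : z ∈ V) :
    z ≠ 0 ∧ p z ≠ 0 ∧ HasDerivAt p (α * p z / z) z := by
  have hVz := hV.mem_nhds hz
  cases h with
  | ofLog l hl hexp hp =>
    have hz0 : z ≠ 0 := by rw [← hexp z hz]; exact exp_ne_zero _
    refine ⟨hz0, hasDerivAt_exp_mul hz0 one_ne_zero (hl.continuousAt hVz) ?_ ?_⟩
    · filter_upwards [hVz] with w hw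
      rw [hexp w hw, one_mul]
    · filter_upwards [hVz] with w hw using hp w hw
  | ofRoot a b hb hα h0 hc hp =>
    have hz0 : z ≠ 0 := fun h => h0 (h ▸ hz)
    have hb0 : b ≠ 0 := by rintro rfl; exact absurd hb (by decide)
    have hpz : p z ≠ 0 := fun h => by
      have h1 := hp z hz
      rw [h, zero_pow hb0] at h1
      exact zpow_ne_zero a hz0 h1.symm
    have hbk : (b : 𝕜) ≠ 0 := Nat.cast_ne_zero.2 hb0
    refine ⟨hz0, hpz, ?_⟩
    have h1 := hasDerivAt_of_comp_eq (hc.continuousAt hVz) (hasStrictDerivAt_pow b (p z))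
      (mul_ne_zero hbk (pow_ne_zero _ hpz)) (hasDerivAt_zpow a z (Or.inl hz0))
      (by filter_upwards [hVz] with w hw using hp w hw)
    refine h1.congr_deriv ?_
    have h2 : p z ^ b = p z ^ (b - 1) * p z := by
      rw [← pow_succ, Nat.sub_add_cancel (Nat.one_le_iff_ne_zero.2 hb0)]
    have h3 : z ^ (a - 1) = p z ^ (b - 1) * p z / z := by
      rw [zpow_sub_one₀ hz0, ← hp z hz, h2, div_eq_mul_inv]
    have h4 : p z ^ (b - 1) ≠ 0 := pow_ne_zero _ hpz
    rw [h3, hα]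
    field_simp
  | ofAbs hreal h0 hp =>
    have hz0 : z ≠ 0 := fun h => h0 (h ▸ hz)
    refine ⟨hz0, ?_⟩
    have hre : ∀ w : 𝕜, ((RCLike.re w : ℝ) : 𝕜) = w := fun w => RCLike.conj_eq_iff_re.1 (hreal w)
    have hnorm : ∀ w : 𝕜, ‖w‖ = |RCLike.re w| := fun w => by
      conv_lhs => rw [← hre w]
      rw [RCLike.norm_ofReal]
    have hrez : RCLike.re z ≠ 0 := fun h => hz0 (by rw [← hre z, h, RCLike.ofReal_zero])
    have hne : ∀ᶠ w : 𝕜 in nhds z, w ≠ 0 := isOpen_ne.mem_nhds hz0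
    have hexp : ∀ᶠ w : 𝕜 in nhds z,
        NormedSpace.exp ((Real.log ‖w‖ : ℝ) : 𝕜) = ((‖w‖ : ℝ) : 𝕜) := by
      filter_upwards [hne] with w hw
      rw [exp_ofReal, Real.exp_log (norm_pos_iff.2 hw)]
    have hl : ContinuousAt (fun w : 𝕜 => ((Real.log ‖w‖ : ℝ) : 𝕜)) z :=
      RCLike.continuous_ofReal.continuousAt.comp
        (continuous_norm.continuousAt.log (norm_ne_zero_iff.2 hz0))
    have hpw : ∀ᶠ w in nhds z, p w = NormedSpace.exp (α * ((Real.log ‖w‖ : ℝ) : 𝕜)) := by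
      filter_upwards [hVz, hne] with w hw hw0
      rw [hp w hw, Real.rpow_def_of_pos (norm_pos_iff.2 hw0), ← exp_ofReal, RCLike.ofReal_mul,
        hre, mul_comm]
    -- Near `z` the absolute value is `w` or `-w`.
    rcases lt_or_gt_of_ne hrez with hneg | hpos
    · refine hasDerivAt_exp_mul (c := -1) hz0 (by simp) hl ?_ hpw
      filter_upwards [hexp, (RCLike.continuous_re.tendsto z).eventually (gt_mem_nhds hneg)]
        with w hw1 hw2
      rw [hw1, hnorm, abs_of_neg hw2, RCLike.ofReal_neg, hre, neg_one_mul]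
    · refine hasDerivAt_exp_mul (c := 1) hz0 one_ne_zero hl ?_ hpw
      filter_upwards [hexp, (RCLike.continuous_re.tendsto z).eventually (lt_mem_nhds hpos)]
        with w hw1 hw2
      rw [hw1, hnorm, abs_of_pos hw2, hre, one_mul]

theorem IsPowerOn.contDiffOn {α : 𝕜} {V : Set 𝕜} {p : 𝕜 → 𝕜} (hV : IsOpen V)
    (h : IsPowerOn α V p) : ContDiffOn 𝕜 ∞ p V := by
  have hd : DifferentiableOn 𝕜 p V := fun z hz =>
    (h.hasDerivAt hV hz).2.2.differentiableAt.differentiableWithinAt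
  rw [contDiffOn_infty]
  intro m
  induction m with
  | zero => exact contDiffOn_zero.2 hd.continuousOn
  | succ m ih =>
    push_cast
    rw [contDiffOn_succ_iff_deriv_of_isOpen hV]
    refine ⟨hd, fun hm => absurd hm (by simp), ?_⟩
    have h1 : ContDiffOn 𝕜 m (fun z => α * p z / z) V :=
      (contDiffOn_const.mul ih).div contDiffOn_id fun z hz => (h.hasDerivAt hV hz).1
    exact h1.congr fun z hz => (h.hasDerivAt hV hz).2.2.deriv

theorem hasDerivAt_exp_const_mul (c t : 𝕜) :
    HasDerivAt (fun t => NormedSpace.exp (c * t)) (NormedSpace.exp (c * t) * c) t := by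
  have h1 := (hasDerivAt_exp (x := c * t)).comp t ((hasDerivAt_id t).const_mul c)
  rwa [mul_one] at h1

theorem eq_of_hasDerivAt_zero {O : Set 𝕜} {g : 𝕜 → 𝕜} (hO : IsOpen O)
    (hg : ∀ e ∈ O, HasDerivAt g 0 e) {ε : unitInterval → 𝕜} (hε : Continuous ε)
    (hεO : ∀ t, ε t ∈ O) : g (ε 1) = g (ε 0) := by
  have hloc : IsLocallyConstant fun t => g (ε t) := fun s => by
    have h1 : IsOpen (O ∩ g ⁻¹' s) := hO.isOpen_inter_preimage_of_fderiv_eq_zero (𝕜 := 𝕜)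
      (fun e he => (hg e he).differentiableAt.differentiableWithinAt)
      (fun e he => by
        have := (hg e he).hasFDerivAt.fderiv
        simpa using this) s
    have h2 : (fun t => g (ε t)) ⁻¹' s = ε ⁻¹' (O ∩ g ⁻¹' s) := by
      ext t
      simp [hεO t]
    rw [h2]
    exact h1.preimage hε
  exact hloc.apply_eq_of_preconnectedSpace 1 0

/-- Along a curve `(e^{s ε} m, e^{-α s ε} m')` the product `p(m) m'` with a determination `p` of
the power `α` does not change. -/
theorem IsPowerOn.mul_eq {α : 𝕜} {V : Set 𝕜} {p : 𝕜 → 𝕜} (hV : IsOpen V) (h : IsPowerOn α V p)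
    {s s' m m' : 𝕜} (hs : s' = -(α * s)) {ε : unitInterval → 𝕜} (hε : Continuous ε)
    (hεV : ∀ t, NormedSpace.exp (s * ε t) * m ∈ V) :
    p (NormedSpace.exp (s * ε 1) * m) * (NormedSpace.exp (s' * ε 1) * m') =
      p (NormedSpace.exp (s * ε 0) * m) * (NormedSpace.exp (s' * ε 0) * m') := by
  have hcont : Continuous fun e : 𝕜 => NormedSpace.exp (s * e) * m :=
    continuous_iff_continuousAt.2 fun e => ((hasDerivAt_exp_const_mul s e).mul_const m).continuousAt
  refine eq_of_hasDerivAt_zero (O := {e | NormedSpace.exp (s * e) * m ∈ V})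
    (g := fun e => p (NormedSpace.exp (s * e) * m) * (NormedSpace.exp (s' * e) * m'))
    (hV.preimage hcont) (fun e he => ?_) hε hεV
  obtain ⟨hz0, -, hd⟩ := h.hasDerivAt hV he
  have h1 := (HasDerivAt.comp e hd ((hasDerivAt_exp_const_mul s e).mul_const m)).mul
    ((hasDerivAt_exp_const_mul s' e).mul_const m')
  refine h1.congr_deriv ?_
  have hm := right_ne_zero_of_mul hz0
  have he0 := left_ne_zero_of_mul hz0
  simp only [Function.comp_apply]
  rw [hs]
  field_simp
  ring

/-! ### Invariance of the explicit expressions -/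

theorem coAd_one {n : ℕ} {γ : ℕ → 𝕜} (ξ : Module.Dual 𝕜 (tAlg n γ)) :
    coAd (1 : tGrp n γ) ξ = ξ := by
  refine LinearMap.ext fun Y => congrArg ξ (Subtype.ext ?_)
  change (1⁻¹ : tGrp n γ).val.val * Y.val * (1⁻¹⁻¹ : tGrp n γ).val.val = Y.val
  simp

theorem inv_diag {n : ℕ} {γ : ℕ → 𝕜} (B : tGrp n γ) {e : 𝕜}
    (hB : ∀ i : Fin n, B.val.val i i = NormedSpace.exp (γ (i + 1) * e)) (i : Fin n) :
    (B⁻¹).val.val i i = NormedSpace.exp (-(γ (i + 1) * e)) := by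
  have h1 : B.val.val * (B⁻¹).val.val = 1 := by simp
  have h := diag_mul B.2.1 (B⁻¹).2.1 i
  rw [h1, Matrix.one_apply_eq, hB] at h
  rw [NormedSpace.exp_neg]
  exact eq_inv_of_mul_eq_one_right h.symm

theorem minor_coAd {n k : ℕ} (h : k ≤ n) (hk : 2 * k ≤ n) {γ : ℕ → 𝕜} (B : tGrp n γ) {e : 𝕜}
    (hB : ∀ i : Fin n, B.val.val i i = NormedSpace.exp (γ (i + 1) * e))
    (ξ : Module.Dual 𝕜 (tAlg n γ)) :
    minor k (coords n γ (coAd B ξ)) =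
      NormedSpace.exp (weight n γ k * e) * minor k (coords n γ ξ) := by
  rw [coords_coAd, minor_conj h hk B.2.1 (B⁻¹).2.1, weight_eq h, sub_mul, Finset.sum_mul,
    Finset.sum_mul, sub_eq_add_neg, ← Finset.sum_neg_distrib, NormedSpace.exp_add,
    NormedSpace.exp_sum, NormedSpace.exp_sum]
  simp_rw [inv_diag B hB, hB]
  simp only [Fin.val_castLE]
  ring

theorem isInvariantOn_minor {n k : ℕ} (h : k ≤ n) (hk : 2 * k ≤ n) {γ : ℕ → 𝕜}
    (hw : weight n γ k = 0) : IsInvariantOn n γ Set.univ (minor k) := by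
  intro ξ B ε _ _ hB _ _
  rw [minor_coAd h hk (B 1) (hB 1), hw, zero_mul, NormedSpace.exp_zero, one_mul]

theorem isInvariantOn_singInv {n : ℕ} {γ : ℕ → 𝕜}
    (hγ : ∀ k ∈ Finset.Icc 1 (n / 2), γ k = γ (n - k + 1)) :
    IsInvariantOn n γ {x | ∀ k ∈ Finset.Icc 1 (n / 2), γ k ≠ γ (k + 1) → minor k x ≠ 0}
      (singInv γ) := by
  intro ξ B ε _ _ _ hB0 hW
  have h0 := hW 0
  rw [hB0, coAd_one] at h0
  rw [coords_coAd]
  exact singInv_conj hγ h0 (B 1).2.1 ((B 1)⁻¹).2.1 (by simp)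

theorem isInvariantOn_power {n k k₀ : ℕ} (hk : 2 * k ≤ n) (hk₀ : 2 * k₀ ≤ n) {γ : ℕ → 𝕜} {α : 𝕜}
    (hα : weight n γ k = -(α * weight n γ k₀)) {V : Set 𝕜} (hV : IsOpen V) {p : 𝕜 → 𝕜}
    (hp : IsPowerOn α V p) :
    IsInvariantOn n γ {x | minor k₀ x ∈ V} (fun x => p (minor k₀ x) * minor k x) := by
  intro ξ B ε hε _ hB hB0 hW
  have h1 := fun t => minor_coAd (k := k) (by omega) hk (B t) (hB t) ξ
  have h2 := fun t => minor_coAd (k := k₀) (by omega) hk₀ (B t) (hB t) ξ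
  have h3 := hp.mul_eq hV hα hε (m := minor k₀ (coords n γ ξ)) (m' := minor k (coords n γ ξ))
    fun t => by rw [← h2 t]; exact hW t
  rw [← h1, ← h1, ← h2, ← h2, hB0, coAd_one] at h3
  exact h3

/-! ### Velocities of curves in the group -/

/-- A curve `B` through `1` with the velocity `Z` moves a point with the velocity `tvec γ x Z`. -/
theorem hasDerivAt_coords_coAd {n : ℕ} {γ : ℕ → 𝕜} (ξ : Module.Dual 𝕜 (tAlg n γ))
    {B : 𝕜 → tGrp n γ} (hB0 : B 0 = 1) {Z : Matrix (Fin n) (Fin n) 𝕜}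
    (hZ : ∀ i j, HasDerivAt (fun t => (B t).val.val i j) (Z i j) 0)
    (hZ' : ∀ i j, HasDerivAt (fun t => ((B t)⁻¹).val.val i j) (-Z i j) 0) :
    HasDerivAt (fun t => coords n γ (coAd (B t) ξ)) (tvec γ (coords n γ ξ) Z) 0 := by
  set L := low (coords n γ ξ) with hL
  have hentry : ∀ i j, HasDerivAt (fun t => ((B t).val.val * L * ((B t)⁻¹).val.val) i j)
      ((Z * L - L * Z) i j) 0 := by
    intro i j
    have h1 : ∀ l, HasDerivAt (fun t => ((B t).val.val * L) i l) ((Z * L) i l) 0 := fun l => by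
      simp only [Matrix.mul_apply]
      exact HasDerivAt.fun_sum fun m _ => (hZ i m).mul_const (L m l)
    have h2 : HasDerivAt (fun t => ((B t).val.val * L * ((B t)⁻¹).val.val) i j)
        (∑ l, ((Z * L) i l * ((B 0)⁻¹).val.val l j + ((B 0).val.val * L) i l * -Z l j)) 0 := by
      simp only [Matrix.mul_apply (M := (B _).val.val * L)]
      exact HasDerivAt.fun_sum fun l _ => (h1 l).mul (hZ' l j)
    refine h2.congr_deriv ?_
    rw [hB0]
    simp only [inv_one, Subgroup.coe_one, Units.val_one, Matrix.one_mul, Matrix.one_apply,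
      Finset.sum_add_distrib, mul_neg, Finset.sum_neg_distrib, Matrix.sub_apply]
    rw [← Matrix.mul_apply, ← sub_eq_add_neg]
    simp
  simp only [coords_coAd, ← hL]
  refine hasDerivAt_pi.2 fun p => ?_
  rcases p with _ | p
  · simp only [ofLow, tvec_apply, Gam, Matrix.trace, Matrix.diag_apply, Matrix.diagonal_mul]
    exact (HasDerivAt.fun_sum fun i _ => (hentry i i).const_mul _).const_add _
  · exact hentry _ _

/-- The differential of an invariant annihilates the velocity of a curve in the group. -/
theorem IsInvariantOn.fderiv_tvec {n : ℕ} {γ : ℕ → 𝕜} {W : Set (Idx n → 𝕜)} (hW : IsOpen W)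
    {H : (Idx n → 𝕜) → 𝕜} (hH : ContDiffOn 𝕜 ∞ H W) (hinv : IsInvariantOn n γ W H)
    (ξ : Module.Dual 𝕜 (tAlg n γ)) (hξ : coords n γ ξ ∈ W)
    {B : 𝕜 → tGrp n γ} (hB0 : B 0 = 1) (hBc : Continuous fun t => (B t).val.val)
    {ε : 𝕜 → 𝕜} (hε : Continuous ε)
    (hBε : ∀ t, ∀ i : Fin n, (B t).val.val i i = NormedSpace.exp (γ (i + 1) * ε t))
    {Z : Matrix (Fin n) (Fin n) 𝕜}
    (hZ : ∀ i j, HasDerivAt (fun t => (B t).val.val i j) (Z i j) 0)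
    (hZ' : ∀ i j, HasDerivAt (fun t => ((B t)⁻¹).val.val i j) (-Z i j) 0) :
    fderiv 𝕜 H (coords n γ ξ) (tvec γ (coords n γ ξ) Z) = 0 := by
  have hc := hasDerivAt_coords_coAd ξ hB0 hZ hZ'
  have hc0 : coords n γ (coAd (B 0) ξ) = coords n γ ξ := by rw [hB0, coAd_one]
  have hHd : HasFDerivAt H (fderiv 𝕜 H (coords n γ ξ)) (coords n γ (coAd (B 0) ξ)) := by
    rw [hc0]
    exact ((hH.contDiffAt (hW.mem_nhds hξ)).differentiableAt (by simp)).hasFDerivAt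
  have hcomp := hHd.comp_hasDerivAt 0 hc
  obtain ⟨r, hr, hball⟩ := Metric.eventually_nhds_iff_ball.1
    (hc.continuousAt.eventually_mem (hW.mem_nhds (hc0.symm ▸ hξ)))
  have hconst : ∀ᶠ t in nhds (0 : 𝕜), H (coords n γ (coAd (B t) ξ)) = H (coords n γ ξ) := by
    filter_upwards [Metric.ball_mem_nhds 0 hr] with t ht
    have hs : Continuous fun s : unitInterval => ((s : ℝ) : 𝕜) * t :=
      (RCLike.continuous_ofReal.comp continuous_subtype_val).mul continuous_const
    have h1 := hinv ξ (fun s => B (((s : ℝ) : 𝕜) * t)) (fun s => ε (((s : ℝ) : 𝕜) * t))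
      (hε.comp hs) (hBc.comp hs) (fun s => hBε _) (by simp [hB0]) (fun s => hball _ ?_)
    · simpa using h1
    · rw [mem_ball_zero_iff] at ht ⊢
      rw [norm_mul, RCLike.norm_ofReal, abs_of_nonneg s.2.1]
      exact (mul_le_of_le_one_left (norm_nonneg t) s.2.2).trans_lt ht
  exact hcomp.unique ((hasDerivAt_const (0 : 𝕜) (H (coords n γ ξ))).congr_of_eventuallyEq hconst)

theorem transvection_diag {n : ℕ} {i j : Fin n} (h : i < j) (t : 𝕜) (l : Fin n) :
    Matrix.transvection i j t l l = 1 := by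
  rw [Matrix.transvection, Matrix.add_apply, Matrix.one_apply_eq, Matrix.single_apply_of_ne,
    add_zero]
  rintro ⟨h1, h2⟩
  exact h.ne (h1.trans h2.symm)

/-- The one-parameter group `1 + t e_{ij}`, `i < j`. -/
noncomputable def elemCurve {n : ℕ} (γ : ℕ → 𝕜) {i j : Fin n} (h : i < j) (t : 𝕜) : tGrp n γ :=
  ⟨⟨Matrix.transvection i j t, Matrix.transvection i j (-t),
    by rw [Matrix.transvection_mul_transvection_same _ _ h.ne, add_neg_cancel,
      Matrix.transvection_zero],
    by rw [Matrix.transvection_mul_transvection_same _ _ h.ne, neg_add_cancel,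
      Matrix.transvection_zero]⟩,
    Matrix.blockTriangular_one.add (Matrix.blockTriangular_single h.le t), 0, fun l => by
      rw [mul_zero, NormedSpace.exp_zero]
      exact transvection_diag h t l⟩

theorem elemCurve_zero {n : ℕ} (γ : ℕ → 𝕜) {i j : Fin n} (h : i < j) :
    elemCurve γ h 0 = 1 := Subtype.ext (Units.ext (Matrix.transvection_zero i j))

theorem elemCurve_diag {n : ℕ} (γ : ℕ → 𝕜) {i j : Fin n} (h : i < j) (t : 𝕜) (l : Fin n) :
    (elemCurve γ h t).val.val l l = NormedSpace.exp (γ (l + 1) * 0) := by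
  rw [mul_zero, NormedSpace.exp_zero]
  exact transvection_diag h t l

theorem hasDerivAt_transvection {n : ℕ} (i j a b : Fin n) (c : 𝕜) :
    HasDerivAt (fun t : 𝕜 => Matrix.transvection i j (c * t) a b)
      (c * Matrix.single i j (1 : 𝕜) a b) 0 := by
  have h1 : (fun t : 𝕜 => Matrix.transvection i j (c * t) a b) =
      fun t => (1 : Matrix (Fin n) (Fin n) 𝕜) a b + t * (c * Matrix.single i j (1 : 𝕜) a b) := by
    funext t
    simp only [Matrix.transvection, Matrix.add_apply, Matrix.single_apply]
    split_ifs <;> ring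
  rw [h1]
  simpa using ((hasDerivAt_id (0 : 𝕜)).mul_const
    (c * Matrix.single i j (1 : 𝕜) a b)).const_add ((1 : Matrix (Fin n) (Fin n) 𝕜) a b)

theorem hasDerivAt_elemCurve {n : ℕ} (γ : ℕ → 𝕜) {i j : Fin n} (h : i < j) (a b : Fin n) :
    HasDerivAt (fun t => (elemCurve γ h t).val.val a b) (Matrix.single i j (1 : 𝕜) a b) 0 ∧
    HasDerivAt (fun t => ((elemCurve γ h t)⁻¹).val.val a b) (-Matrix.single i j (1 : 𝕜) a b) 0 := by
  have h1 := hasDerivAt_transvection i j a b (1 : 𝕜)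
  have h2 := hasDerivAt_transvection i j a b (-1 : 𝕜)
  simp only [one_mul, neg_one_mul] at h1 h2
  exact ⟨h1, h2⟩

theorem continuous_elemCurve {n : ℕ} (γ : ℕ → 𝕜) {i j : Fin n} (h : i < j) :
    Continuous fun t => (elemCurve γ h t).val.val := by
  refine continuous_matrix fun a b => ?_
  change Continuous fun t => (1 + Matrix.single i j t : Matrix (Fin n) (Fin n) 𝕜) a b
  simp only [Matrix.add_apply, Matrix.single_apply]
  split_ifs <;> fun_prop

/-- The one-parameter group `exp(t Γ)`. -/
noncomputable def torusCurve (n : ℕ) (γ : ℕ → 𝕜) (t : 𝕜) : tGrp n γ :=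
  ⟨⟨Matrix.diagonal fun i => NormedSpace.exp (γ (i + 1) * t),
    Matrix.diagonal fun i => NormedSpace.exp (-(γ (i + 1) * t)),
    by simp [Matrix.diagonal_mul_diagonal, ← NormedSpace.exp_add],
    by simp [Matrix.diagonal_mul_diagonal, ← NormedSpace.exp_add]⟩,
    Matrix.blockTriangular_diagonal _, t, fun i => Matrix.diagonal_apply_eq _ i⟩

theorem torusCurve_zero (n : ℕ) (γ : ℕ → 𝕜) : torusCurve n γ 0 = 1 :=
  Subtype.ext (Units.ext (by simp [torusCurve]))

theorem hasDerivAt_torusCurve (n : ℕ) (γ : ℕ → 𝕜) (a b : Fin n) :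
    HasDerivAt (fun t => (torusCurve n γ t).val.val a b) (Gam n γ a b) 0 ∧
    HasDerivAt (fun t => ((torusCurve n γ t)⁻¹).val.val a b) (-Gam n γ a b) 0 := by
  change HasDerivAt (fun t => Matrix.diagonal (fun i : Fin n =>
      NormedSpace.exp (γ (i + 1) * t)) a b) _ 0 ∧
    HasDerivAt (fun t => Matrix.diagonal (fun i : Fin n =>
      NormedSpace.exp (-(γ (i + 1) * t))) a b) _ 0
  by_cases h : a = b
  · subst h
    simp only [Matrix.diagonal_apply_eq, Gam, ← neg_mul]
    exact ⟨by simpa using hasDerivAt_exp_const_mul (γ (a + 1)) 0,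
      by simpa using hasDerivAt_exp_const_mul (-γ (a + 1)) 0⟩
  · simp only [Matrix.diagonal_apply_ne _ h, Gam, neg_zero]
    exact ⟨hasDerivAt_const _ _, hasDerivAt_const _ _⟩

theorem continuous_torusCurve (n : ℕ) (γ : ℕ → 𝕜) :
    Continuous fun t => (torusCurve n γ t).val.val := by
  refine Continuous.matrix_diagonal (continuous_pi fun i => ?_)
  exact continuous_iff_continuousAt.2 fun t => (hasDerivAt_exp_const_mul _ t).continuousAt

theorem IsInvariantOn.fderiv_tvec_single {n : ℕ} {γ : ℕ → 𝕜} (hγ : ∃ i : Fin n, γ (i + 1) ≠ 0)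
    {W : Set (Idx n → 𝕜)} (hW : IsOpen W) {H : (Idx n → 𝕜) → 𝕜} (hH : ContDiffOn 𝕜 ∞ H W)
    (hinv : IsInvariantOn n γ W H) {x : Idx n → 𝕜} (hx : x ∈ W) {i j : Fin n} (h : i < j) :
    fderiv 𝕜 H x (tvec γ x (Matrix.single i j 1)) = 0 := by
  obtain ⟨i₀, h₀⟩ := hγ
  obtain ⟨ξ, rfl⟩ := (coords_bijective n γ i₀ h₀).2 x
  exact hinv.fderiv_tvec hW hH ξ hx (elemCurve_zero γ h) (continuous_elemCurve γ h)
    (ε := fun _ => 0) continuous_const (elemCurve_diag γ h)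
    (fun a b => (hasDerivAt_elemCurve γ h a b).1) fun a b => (hasDerivAt_elemCurve γ h a b).2

theorem IsInvariantOn.fderiv_tvec_gam {n : ℕ} {γ : ℕ → 𝕜} (hγ : ∃ i : Fin n, γ (i + 1) ≠ 0)
    {W : Set (Idx n → 𝕜)} (hW : IsOpen W) {H : (Idx n → 𝕜) → 𝕜} (hH : ContDiffOn 𝕜 ∞ H W)
    (hinv : IsInvariantOn n γ W H) {x : Idx n → 𝕜} (hx : x ∈ W) :
    fderiv 𝕜 H x (tvec γ x (Gam n γ)) = 0 := by
  obtain ⟨i₀, h₀⟩ := hγ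
  obtain ⟨ξ, rfl⟩ := (coords_bijective n γ i₀ h₀).2 x
  exact hinv.fderiv_tvec hW hH ξ hx (torusCurve_zero n γ) (continuous_torusCurve n γ)
    (ε := fun t => t) continuous_id (fun _ i => Matrix.diagonal_apply_eq _ i)
    (fun a b => (hasDerivAt_torusCurve n γ a b).1) fun a b => (hasDerivAt_torusCurve n γ a b).2

/-! ### Differentials of the explicit expressions -/

theorem contDiff_X {n : ℕ} (i j : ℕ) : ContDiff 𝕜 ∞ fun x : Idx n → 𝕜 => X x i j := by
  unfold X
  split_ifs
  · exact contDiff_apply 𝕜 𝕜 _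
  · exact contDiff_const

theorem contDiff_det {E : Type*} [NormedAddCommGroup E] [NormedSpace 𝕜 E] {k : ℕ}
    {A : E → Matrix (Fin k) (Fin k) 𝕜} (hA : ∀ i j, ContDiff 𝕜 ∞ fun x => A x i j) :
    ContDiff 𝕜 ∞ fun x => (A x).det := by
  simp only [Matrix.det_apply']
  exact ContDiff.sum fun σ _ => contDiff_const.mul (contDiff_prod fun i _ => hA _ _)

theorem contDiff_minor {n : ℕ} (k : ℕ) : ContDiff 𝕜 ∞ (minor (𝕜 := 𝕜) (n := n) k) :=
  contDiff_det fun _ _ => contDiff_X _ _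

theorem contDiff_bordered {n : ℕ} (k i : ℕ) : ContDiff 𝕜 ∞ (bordered (𝕜 := 𝕜) (n := n) k i) := by
  refine contDiff_det fun a b => ?_
  refine Fin.cases ?_ (fun a => ?_) a <;> refine Fin.lastCases ?_ (fun b => ?_) b <;>
    simp only [Matrix.of_apply, Fin.cons_zero, Fin.cons_succ, Fin.snoc_last, Fin.snoc_castSucc]
  exacts [contDiff_const, contDiff_X _ _, contDiff_X _ _, contDiff_X _ _]

theorem contDiffOn_singInv {n : ℕ} (γ : ℕ → 𝕜) :
    ContDiffOn 𝕜 ∞ (singInv (n := n) γ)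
      {x | ∀ k ∈ Finset.Icc 1 (n / 2), γ k ≠ γ (k + 1) → minor k x ≠ 0} := by
  refine (contDiff_apply 𝕜 𝕜 none).contDiffOn.add (ContDiffOn.sum fun k hk => ?_)
  refine ContDiffOn.mul ?_ (ContDiff.sum fun i _ => contDiff_bordered k i).contDiffOn
  by_cases he : γ k = γ (k + 1)
  · simp only [he, sub_self, mul_zero]
    exact contDiffOn_const
  · exact (contDiffOn_const.div (contDiff_minor k).contDiffOn
      fun x (hx : ∀ k ∈ Finset.Icc 1 (n / 2), γ k ≠ γ (k + 1) → minor k x ≠ 0) => hx k hk he).mul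
      contDiffOn_const

theorem fderiv_eq_of_line {E : Type*} [NormedAddCommGroup E] [NormedSpace 𝕜 E] {f : E → 𝕜}
    {x v : E} {c : 𝕜} (hf : DifferentiableAt 𝕜 f x) (hl : ∀ t : 𝕜, f (x + t • v) = f x + t * c) :
    fderiv 𝕜 f x v = c := by
  have h1 : HasDerivAt (fun t : 𝕜 => x + t • v) v 0 := by
    simpa using ((hasDerivAt_id (0 : 𝕜)).smul_const v).const_add x
  have h2 : HasFDerivAt f (fderiv 𝕜 f x) (x + (0 : 𝕜) • v) := by
    simpa using hf.hasFDerivAt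
  have h3 := h2.comp_hasDerivAt 0 h1
  have h4 : HasDerivAt (fun t : 𝕜 => f (x + t • v)) c 0 := by
    simp only [hl]
    simpa using ((hasDerivAt_id (0 : 𝕜)).mul_const c).const_add (f x)
  exact h3.unique h4

theorem differentiableAt_minor {n : ℕ} (k : ℕ) (x : Idx n → 𝕜) :
    DifferentiableAt 𝕜 (minor (n := n) k) x :=
  (contDiff_minor k).contDiffAt.differentiableAt (by simp)

theorem X_add_none {n : ℕ} (x : Idx n → 𝕜) (t : 𝕜) (i j : ℕ) :
    X (x + t • Pi.single none 1) i j = X x i j := by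
  unfold X
  split_ifs
  · simp
  · rfl

theorem fderiv_minor_none {n : ℕ} (k : ℕ) (x : Idx n → 𝕜) :
    fderiv 𝕜 (minor k) x (Pi.single none 1) = 0 :=
  fderiv_eq_of_line (differentiableAt_minor k x) fun t => by
    simp only [minor, X_add_none, mul_zero, add_zero]

theorem fderiv_singInv_none {n : ℕ} {γ : ℕ → 𝕜} {x : Idx n → 𝕜}
    (hx : DifferentiableAt 𝕜 (singInv (n := n) γ) x) :
    fderiv 𝕜 (singInv γ) x (Pi.single none 1) = 1 :=
  fderiv_eq_of_line hx fun t => by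
    simp only [singInv, minor, bordered, X_add_none, Pi.add_apply, Pi.smul_apply,
      Pi.single_eq_same, smul_eq_mul]
    ring

theorem fderiv_minor_antiIdx {n k : ℕ} (h : 2 * (k + 1) ≤ n) (x : Idx n → 𝕜) :
    fderiv 𝕜 (minor (k + 1)) x (Pi.single (antiIdx h) 1) = (-1) ^ k * minor k x :=
  fderiv_eq_of_line (differentiableAt_minor _ x) (minor_succ_add h x)

theorem fderiv_minor_antiIdx_of_le {n k l : ℕ} (h : 2 * (k + 1) ≤ n) (hl : l ≤ k)
    (x : Idx n → 𝕜) : fderiv 𝕜 (minor l) x (Pi.single (antiIdx h) 1) = 0 :=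
  fderiv_eq_of_line (differentiableAt_minor _ x) fun t => by
    rw [minor_add_of_le h hl, mul_zero, add_zero]

theorem fderiv_minor_tvec_single {n k : ℕ} (hk : 2 * k ≤ n) {γ : ℕ → 𝕜}
    (hγ : ∃ i : Fin n, γ (i + 1) ≠ 0) (x : Idx n → 𝕜) {i j : Fin n} (h : i < j) :
    fderiv 𝕜 (minor k) x (tvec γ x (Matrix.single i j 1)) = 0 := by
  obtain ⟨i₀, h₀⟩ := hγ
  obtain ⟨ξ, rfl⟩ := (coords_bijective n γ i₀ h₀).2 x
  have hc := hasDerivAt_coords_coAd ξ (elemCurve_zero γ h)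
    (fun a b => (hasDerivAt_elemCurve γ h a b).1) fun a b => (hasDerivAt_elemCurve γ h a b).2
  have hd := (differentiableAt_minor (𝕜 := 𝕜) k
    (coords n γ (coAd (elemCurve γ h 0) ξ))).hasFDerivAt
  have h1 := hd.comp_hasDerivAt 0 hc
  rw [elemCurve_zero, coAd_one] at h1
  refine h1.unique ((hasDerivAt_const (0 : 𝕜) (minor k (coords n γ ξ))).congr_of_eventuallyEq
    (Filter.Eventually.of_forall fun t => ?_))
  rw [Function.comp_apply, minor_coAd (by omega) hk _ (elemCurve_diag γ h t), mul_zero,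
    NormedSpace.exp_zero, one_mul]

theorem fderiv_minor_tvec_gam {n k : ℕ} (hk : 2 * k ≤ n) {γ : ℕ → 𝕜}
    (hγ : ∃ i : Fin n, γ (i + 1) ≠ 0) (x : Idx n → 𝕜) :
    fderiv 𝕜 (minor k) x (tvec γ x (Gam n γ)) = weight n γ k * minor k x := by
  obtain ⟨i₀, h₀⟩ := hγ
  obtain ⟨ξ, rfl⟩ := (coords_bijective n γ i₀ h₀).2 x
  have hc := hasDerivAt_coords_coAd ξ (torusCurve_zero n γ)
    (fun a b => (hasDerivAt_torusCurve n γ a b).1) fun a b => (hasDerivAt_torusCurve n γ a b).2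
  have hd := (differentiableAt_minor (𝕜 := 𝕜) k
    (coords n γ (coAd (torusCurve n γ 0) ξ))).hasFDerivAt
  have h1 := hd.comp_hasDerivAt 0 hc
  rw [torusCurve_zero, coAd_one] at h1
  have h2 := (hasDerivAt_exp_const_mul (weight n γ k) 0).mul_const (minor k (coords n γ ξ))
  rw [mul_zero, NormedSpace.exp_zero, one_mul] at h2
  refine h1.unique (h2.congr_of_eventuallyEq (Filter.Eventually.of_forall fun t => ?_))
  rw [Function.comp_apply, minor_coAd (by omega) hk _ fun i => Matrix.diagonal_apply_eq _ i]

/-! ### Generic points and the differentials of the corner minors -/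

/-- The set where the corner minors of the orders up to `m` do not vanish. -/
def genericSet (𝕜 : Type*) [RCLike 𝕜] (n m : ℕ) : Set (Idx n → 𝕜) :=
  {x | ∀ k ∈ Finset.Icc 1 m, minor k x ≠ 0}

theorem isOpen_genericSet (n m : ℕ) : IsOpen (genericSet 𝕜 n m) := by
  have : genericSet 𝕜 n m = ⋂ k ∈ Finset.Icc 1 m, {x | minor k x ≠ 0} := by
    ext x; simp [genericSet]
  rw [this]
  exact isOpen_biInter_finset fun k _ => isOpen_ne_fun (contDiff_minor k).continuous
    continuous_const

theorem dense_genericSet {n m : ℕ} (hm : 2 * m ≤ n) : Dense (genericSet 𝕜 n m) := by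
  induction m with
  | zero =>
    have : genericSet 𝕜 n 0 = Set.univ := by ext x; simp [genericSet]
    rw [this]
    exact dense_univ
  | succ m ih =>
    refine dense_closure.1 ((ih (by omega)).mono fun x hx => ?_)
    have hmem : ∀ y : Idx n → 𝕜, y ∈ genericSet 𝕜 n m → minor (m + 1) y ≠ 0 →
        y ∈ genericSet 𝕜 n (m + 1) := fun y hy hy' k hk => by
      rw [Finset.mem_Icc] at hk
      rcases Nat.lt_succ_iff_lt_or_eq.1 (Nat.lt_succ_of_le hk.2) with h | rfl
      · exact hy k (by rw [Finset.mem_Icc]; omega)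
      · exact hy'
    by_cases h0 : minor (m + 1) x = 0
    · have hmx : minor m x ≠ 0 := by
        rcases Nat.eq_zero_or_pos m with rfl | h
        · rw [minor_zero]; exact one_ne_zero
        · exact hx m (by rw [Finset.mem_Icc]; omega)
      have hlim : Filter.Tendsto (fun t : 𝕜 => x + t • Pi.single (antiIdx hm) (1 : 𝕜))
          (nhdsWithin 0 {0}ᶜ) (nhds x) := by
        have hc : Continuous fun t : 𝕜 => x + t • Pi.single (antiIdx hm) (1 : 𝕜) := by fun_prop
        have h1 := hc.tendsto 0
        rw [zero_smul, add_zero] at h1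
        exact h1.mono_left nhdsWithin_le_nhds
      refine mem_closure_of_tendsto hlim ?_
      filter_upwards [self_mem_nhdsWithin] with t ht
      refine hmem _ (fun k hk => ?_) ?_
      · rw [minor_add_of_le hm (Finset.mem_Icc.1 hk).2]
        exact hx k hk
      · rw [minor_succ_add, h0, zero_add]
        exact mul_ne_zero ht (mul_ne_zero (pow_ne_zero _ (by simp)) hmx)
    · exact subset_closure (hmem x hx h0)

/-- The values of the differentials of the corner minors on the antidiagonal coordinates form a
triangular matrix that is invertible at a generic point. -/
theorem exists_antidiagonal_matrix {n : ℕ} {x : Idx n → 𝕜} (hx : x ∈ genericSet 𝕜 n (n / 2)) :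
    ∃ e : Fin (n / 2) → Idx n,
      (∀ k (h : 2 * (k + 1) ≤ n), antiIdx h = e ⟨k, by omega⟩) ∧
      (Matrix.of fun j k : Fin (n / 2) =>
        fderiv 𝕜 (minor (k + 1)) x (Pi.single (e j) 1)).det ≠ 0 := by
  refine ⟨fun j => antiIdx (n := n) (k := j) (by omega), fun _ _ => rfl, ?_⟩
  rw [Matrix.det_of_isUpperTriangular, Finset.prod_ne_zero_iff]
  · intro j _
    rw [Matrix.of_apply, fderiv_minor_antiIdx]
    refine mul_ne_zero (pow_ne_zero _ (by simp)) ?_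
    rcases Nat.eq_zero_or_pos j.val with h | h
    · rw [h, minor_zero]; exact one_ne_zero
    · exact hx j (by rw [Finset.mem_Icc]; omega)
  · intro j k hjk
    exact fderiv_minor_antiIdx_of_le _ (Fin.lt_def.1 hjk) x

theorem sum_Icc_eq_sum_fin {M : Type*} [AddCommMonoid M] (m : ℕ) (f : ℕ → M) :
    ∑ k ∈ Finset.Icc 1 m, f k = ∑ k : Fin m, f (k + 1) := by
  rw [Fin.sum_univ_eq_sum_range (fun k => f (k + 1)), Finset.range_eq_Ico,
    Finset.sum_Ico_add' f 0 m 1, zero_add, Finset.Ico_add_one_right_eq_Icc]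

theorem fderiv_minor_independent {n : ℕ} {x : Idx n → 𝕜} (hx : x ∈ genericSet 𝕜 n (n / 2))
    (c : ℕ → 𝕜) (hc : ∑ k ∈ Finset.Icc 1 (n / 2), c k • fderiv 𝕜 (minor k) x = 0) :
    ∀ k ∈ Finset.Icc 1 (n / 2), c k = 0 := by
  obtain ⟨e, -, hdet⟩ := exists_antidiagonal_matrix hx
  have h1 := Matrix.eq_zero_of_mulVec_eq_zero hdet (v := fun k => c (k + 1)) (by
    funext j
    have h2 := DFunLike.congr_fun hc (Pi.single (e j) 1)
    rw [sum_Icc_eq_sum_fin] at h2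
    simpa [Matrix.mulVec, dotProduct, sum_apply, mul_comm] using h2)
  intro k hk
  rw [Finset.mem_Icc] at hk
  have h3 := congrFun h1 ⟨k - 1, by omega⟩
  simp only [Nat.sub_add_cancel hk.1] at h3
  exact h3

/-- At a generic point the covectors that annihilate `∂/∂x₀` and the tangent space of the orbit of
the unipotent group are the combinations of the differentials of the corner minors. -/
theorem exists_eq_sum_fderiv_minor {n : ℕ} {γ : ℕ → 𝕜} (hγ : ∃ i : Fin n, γ (i + 1) ≠ 0)
    {x : Idx n → 𝕜} (hx : x ∈ genericSet 𝕜 n (n / 2)) {φ : (Idx n → 𝕜) →L[𝕜] 𝕜}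
    (h0 : φ (Pi.single none 1) = 0)
    (hφ : ∀ i j, i < j → φ (tvec γ x (Matrix.single i j 1)) = 0) :
    ∃ c : ℕ → 𝕜, φ = ∑ k ∈ Finset.Icc 1 (n / 2), c k • fderiv 𝕜 (minor k) x := by
  obtain ⟨e, he, hdet⟩ := exists_antidiagonal_matrix hx
  set N := Matrix.of fun j k : Fin (n / 2) =>
    fderiv 𝕜 (minor (k + 1)) x (Pi.single (e j) 1) with hN
  set a : Fin (n / 2) → 𝕜 := N⁻¹.mulVec fun j => φ (Pi.single (e j) 1) with ha
  have hNa : ∀ j, ∑ k, N j k * a k = φ (Pi.single (e j) 1) := fun j => by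
    have h1 : N.mulVec a = fun j => φ (Pi.single (e j) 1) := by
      rw [ha, Matrix.mulVec_mulVec, Matrix.mul_nonsing_inv _ hdet.isUnit, Matrix.one_mulVec]
    exact congrFun h1 j
  refine ⟨fun k => if h : k - 1 < n / 2 then a ⟨k - 1, h⟩ else 0, ?_⟩
  rw [sum_Icc_eq_sum_fin]
  simp only [Nat.add_sub_cancel, Fin.is_lt, dif_pos, Fin.eta]
  rw [← sub_eq_zero]
  have hz := dual_eq_zero (γ := γ) hx (φ := (φ - ∑ k : Fin (n / 2),
    a k • fderiv 𝕜 (minor (k + 1)) x : (Idx n → 𝕜) →L[𝕜] 𝕜).toLinearMap) ?_ ?_ ?_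
  · exact ContinuousLinearMap.coe_injective hz
  · simp [h0, fderiv_minor_none]
  · intro i j hij
    have h2 : ∀ k : Fin (n / 2), fderiv 𝕜 (minor (k + 1)) x (tvec γ x (Matrix.single i j 1)) = 0 :=
      fun k => fderiv_minor_tvec_single (by omega) hγ x hij
    simp [hφ i j hij, h2]
  · intro k hk
    rw [he k hk]
    have h3 := hNa ⟨k, by omega⟩
    simp only [hN, Matrix.of_apply] at h3
    rw [ContinuousLinearMap.coe_coe, sub_apply, sum_apply, ← h3, sub_eq_zero]
    exact Finset.sum_congr rfl fun l _ => mul_comm _ _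

/-! ### The two bases -/

theorem weight_eq_zero_of_symm {n k : ℕ} {γ : ℕ → 𝕜}
    (hγ : ∀ i ∈ Finset.Icc 1 k, γ i = γ (n - i + 1)) : weight n γ k = 0 :=
  Finset.sum_eq_zero fun i hi => by rw [← hγ i hi, sub_self]

theorem weight_eq_sum_Icc {n k₀ k : ℕ} {γ : ℕ → 𝕜} (hk₀ : 1 ≤ k₀)
    (hγ : ∀ i ∈ Finset.Ico 1 k₀, γ i = γ (n - i + 1)) :
    weight n γ k = ∑ i ∈ Finset.Icc k₀ k, (γ (n - i + 1) - γ i) := by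
  refine (Finset.sum_subset (Finset.Icc_subset_Icc_left hk₀) fun i hi hi' => ?_).symm
  rw [Finset.mem_Icc] at hi hi'
  rw [← hγ i (by rw [Finset.mem_Ico]; omega), sub_self]

/-- The coefficients of a family indexed by a finset, extended by zero. -/
theorem sum_extend {M ι : Type*} [AddCommMonoid M] [Module 𝕜 M] [DecidableEq ι] (s : Finset ι)
    (g : {k // k ∈ s} → 𝕜) (v : ι → M) :
    ∑ l, g l • v l = ∑ k ∈ s, (if h : k ∈ s then g ⟨k, h⟩ else 0) • v k := by
  rw [← Finset.sum_coe_sort s]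
  exact Finset.sum_congr rfl fun l _ => by rw [dif_pos l.2]

theorem isInvariantBasis_singular {n : ℕ} {γ : ℕ → 𝕜} (hγ0 : ∃ i : Fin n, γ (i + 1) ≠ 0)
    (hγ : ∀ k ∈ Finset.Icc 1 (n / 2), γ k = γ (n - k + 1))
    {dom : Option {k : ℕ // k ∈ Finset.Icc 1 (n / 2)} → Set (Idx n → 𝕜)}
    {F : Option {k : ℕ // k ∈ Finset.Icc 1 (n / 2)} → (Idx n → 𝕜) → 𝕜}
    (hds : ∀ k, dom (some k) = Set.univ)
    (hdn : dom none = {x | ∀ k ∈ Finset.Icc 1 (n / 2), γ k ≠ γ (k + 1) → minor k x ≠ 0})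
    (hFs : ∀ k, F (some k) = minor k.val) (hFn : F none = singInv γ) :
    IsInvariantBasis n γ dom F := by
  have hopen : ∀ l, IsOpen (dom l) := by
    rintro (_ | k)
    · have h1 : dom none = ⋂ k ∈ (Finset.Icc 1 (n / 2)).filter fun k => γ k ≠ γ (k + 1),
          {x | minor k x ≠ 0} := by
        rw [hdn]
        ext x
        simp only [Finset.mem_filter, Set.mem_iInter, Set.mem_ofPred_eq]
        tauto
      rw [h1]
      exact isOpen_biInter_finset fun k _ => isOpen_ne_fun (contDiff_minor k).continuous
        continuous_const
    · rw [hds]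
      exact isOpen_univ
  have hsm : ∀ l, ContDiffOn 𝕜 ∞ (F l) (dom l) := by
    rintro (_ | k)
    · rw [hFn, hdn]
      exact contDiffOn_singInv γ
    · rw [hFs]
      exact (contDiff_minor _).contDiffOn
  have hinv : ∀ l, IsInvariantOn n γ (dom l) (F l) := by
    rintro (_ | k)
    · rw [hFn, hdn]
      exact isInvariantOn_singInv hγ
    · have hk := Finset.mem_Icc.1 k.2
      rw [hFs, hds]
      exact isInvariantOn_minor (by omega) (by omega) (weight_eq_zero_of_symm fun i hi => hγ i (by
        rw [Finset.mem_Icc] at hi ⊢; omega))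
  have hU : ∀ l, genericSet 𝕜 n (n / 2) ⊆ dom l := by
    rintro (_ | k)
    · rw [hdn]
      exact fun x hx k hk _ => hx k hk
    · rw [hds]
      exact Set.subset_univ _
  have hd0 : ∀ x ∈ genericSet 𝕜 n (n / 2), fderiv 𝕜 (F none) x (Pi.single none 1) = 1 :=
    fun x hx => by
    have h1 : DifferentiableAt 𝕜 (F none) x :=
      ((hsm none).contDiffAt ((hopen none).mem_nhds (hU none hx))).differentiableAt (by simp)
    rw [hFn] at h1 ⊢
    exact fderiv_singInv_none h1
  have hLI : ∀ x ∈ genericSet 𝕜 n (n / 2), LinearIndependent 𝕜 fun l => fderiv 𝕜 (F l) x := by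
    intro x hx
    rw [Fintype.linearIndependent_iff]
    intro g hg
    rw [Fintype.sum_option] at hg
    simp only [hFs] at hg
    have h1 := DFunLike.congr_fun hg (Pi.single none 1)
    simp only [add_apply, sum_apply, smul_apply,
      fderiv_minor_none, hd0 x hx, smul_eq_mul, mul_one, mul_zero, Finset.sum_const_zero,
      add_zero, zero_apply] at h1
    rw [h1, zero_smul 𝕜 (fderiv 𝕜 (F none) x), zero_add,
      sum_extend (Finset.Icc 1 (n / 2)) (fun k => g (some k))
      fun k => fderiv 𝕜 (minor k) x] at hg
    have h2 := fderiv_minor_independent hx _ hg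
    rintro (_ | k)
    · exact h1
    · have h3 := h2 k.val k.2
      rwa [dif_pos k.2] at h3
  refine ⟨hopen, hsm, hinv, genericSet 𝕜 n (n / 2), isOpen_genericSet _ _,
    Set.subset_iInter hU, ?_, hLI, ?_⟩
  · rw [(dense_genericSet (by omega)).closure_eq]
    exact Set.subset_univ _
  intro W H hW hH hHinv x hx
  refine exists_eventuallyEq_comp (hW.inter (isOpen_genericSet n (n / 2)))
    (fun l => (hsm l).mono fun y hy => hU l hy.2) (hH.mono Set.inter_subset_left) ?_ hx
    (hLI x hx.2)
  intro y hy
  obtain ⟨c, hc⟩ := exists_eq_sum_fderiv_minor hγ0 hy.2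
    (φ := fderiv 𝕜 H y - fderiv 𝕜 H y (Pi.single none 1) • fderiv 𝕜 (F none) y)
    (by simp [hd0 y hy.2]) fun i j hij => by
      have h1 := hHinv.fderiv_tvec_single hγ0 hW hH hy.1 hij
      have h2 := (hinv none).fderiv_tvec_single hγ0 (hopen none) (hsm none) (hU none hy.2) hij
      simp [h1, h2]
  refine ⟨fun l => l.elim (fderiv 𝕜 H y (Pi.single none 1)) fun k => c k, ?_⟩
  rw [Fintype.sum_option]
  simp only [hFs, Option.elim]
  rw [Finset.sum_coe_sort (Finset.Icc 1 (n / 2)) fun k => c k • fderiv 𝕜 (minor k) y, ← hc,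
    add_sub_cancel]

theorem sum_Icc_split {M : Type*} [AddCommMonoid M] {k₀ N : ℕ} (hk₀ : k₀ ∈ Finset.Icc 1 N)
    (f : ℕ → M) : ∑ k ∈ Finset.Icc 1 N, f k =
      ∑ k ∈ Finset.Ico 1 k₀, f k + f k₀ + ∑ k ∈ Finset.Ioc k₀ N, f k := by
  rw [Finset.mem_Icc] at hk₀
  rw [← Finset.Ico_add_one_right_eq_Icc, ← Finset.sum_Ico_consecutive f hk₀.1 (by omega),
    Finset.sum_eq_sum_Ico_succ_bot (show k₀ < N + 1 by omega), ← add_assoc,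
    ← Finset.Ico_add_one_add_one_eq_Ioc]

theorem isInvariantBasis_regular {n : ℕ} {γ : ℕ → 𝕜} (hγ0 : ∃ i : Fin n, γ (i + 1) ≠ 0)
    {k₀ : ℕ} (hk₀ : k₀ ∈ Finset.Icc 1 (n / 2)) (hne : γ k₀ ≠ γ (n - k₀ + 1))
    (hmin : ∀ k ∈ Finset.Icc 1 (n / 2), k < k₀ → γ k = γ (n - k + 1))
    {V : Set 𝕜} {p : ℕ → 𝕜 → 𝕜} (hV : IsOpen V)
    (hp : ∀ k ∈ Finset.Ioc k₀ (n / 2), IsPowerOn (expo n γ k₀ k) V (p k))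
    {dom : {k : ℕ // k ∈ Finset.Ico 1 k₀} ⊕ {k : ℕ // k ∈ Finset.Ioc k₀ (n / 2)} →
      Set (Idx n → 𝕜)}
    {F : {k : ℕ // k ∈ Finset.Ico 1 k₀} ⊕ {k : ℕ // k ∈ Finset.Ioc k₀ (n / 2)} →
      (Idx n → 𝕜) → 𝕜}
    (hdl : ∀ k, dom (Sum.inl k) = Set.univ) (hdr : ∀ k, dom (Sum.inr k) = {x | minor k₀ x ∈ V})
    (hFl : ∀ k, F (Sum.inl k) = minor k.val)
    (hFr : ∀ k, F (Sum.inr k) = fun x => p k.val (minor k₀ x) * minor k.val x) :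
    IsInvariantBasis n γ dom F := by
  have hk₀' := Finset.mem_Icc.1 hk₀
  have hmin' : ∀ i ∈ Finset.Ico 1 k₀, γ i = γ (n - i + 1) := fun i hi => by
    rw [Finset.mem_Ico] at hi
    exact hmin i (by rw [Finset.mem_Icc]; omega) hi.2
  have hw0 : ∀ k ∈ Finset.Ico 1 k₀, weight n γ k = 0 := fun k hk =>
    weight_eq_zero_of_symm fun i hi => hmin' i (by
      rw [Finset.mem_Icc] at hi; rw [Finset.mem_Ico] at hk ⊢; omega)
  have hwk₀ : weight n γ k₀ = γ (n - k₀ + 1) - γ k₀ := by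
    rw [weight_eq_sum_Icc hk₀'.1 hmin', Finset.Icc_self, Finset.sum_singleton]
  have hwne : weight n γ k₀ ≠ 0 := by
    rw [hwk₀, sub_ne_zero]
    exact hne.symm
  have hα : ∀ k ∈ Finset.Ioc k₀ (n / 2), weight n γ k = -(expo n γ k₀ k * weight n γ k₀) := by
    intro k hk
    rw [Finset.mem_Ioc] at hk
    rw [weight_eq_sum_Icc hk₀'.1 hmin', expo, ← Finset.sum_div, ← hwk₀, neg_mul, neg_neg,
      div_mul_cancel₀ _ hwne]
  have hopen : ∀ l, IsOpen (dom l) := by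
    rintro (k | k)
    · rw [hdl]
      exact isOpen_univ
    · rw [hdr]
      exact hV.preimage (contDiff_minor k₀).continuous
  have hsm : ∀ l, ContDiffOn 𝕜 ∞ (F l) (dom l) := by
    rintro (k | k)
    · rw [hFl]
      exact (contDiff_minor _).contDiffOn
    · rw [hFr, hdr]
      exact (((hp k k.2).contDiffOn hV).comp (contDiff_minor k₀).contDiffOn fun x hx => hx).mul
        (contDiff_minor _).contDiffOn
  have hinv : ∀ l, IsInvariantOn n γ (dom l) (F l) := by
    rintro (k | k)
    · have hk := Finset.mem_Ico.1 k.2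
      rw [hFl, hdl]
      exact isInvariantOn_minor (by omega) (by omega) (hw0 k k.2)
    · have hk := Finset.mem_Ioc.1 k.2
      rw [hFr, hdr]
      exact isInvariantOn_power (by omega) (by omega) (hα k k.2) hV (hp k k.2)
  have hdF : ∀ (k : {k : ℕ // k ∈ Finset.Ioc k₀ (n / 2)}), ∀ x ∈ dom (Sum.inr k),
      fderiv 𝕜 (F (Sum.inr k)) x =
        (expo n γ k₀ k * p k (minor k₀ x) / minor k₀ x * minor k x) • fderiv 𝕜 (minor k₀) x +
          p k (minor k₀ x) • fderiv 𝕜 (minor k.val) x := by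
    intro k x hx
    rw [hdr] at hx
    have h1 := ((hp k k.2).hasDerivAt hV hx).2.2.comp_hasFDerivAt x
      (differentiableAt_minor k₀ x).hasFDerivAt
    have h2 := h1.mul (differentiableAt_minor k.val x).hasFDerivAt
    rw [hFr]
    refine h2.fderiv.trans ?_
    rw [add_comm, smul_smul, mul_comm (minor k.val x)]
    rfl
  have hpne : ∀ (k : {k : ℕ // k ∈ Finset.Ioc k₀ (n / 2)}), ∀ x ∈ dom (Sum.inr k),
      p k (minor k₀ x) ≠ 0 := fun k x hx => by
    rw [hdr] at hx
    exact ((hp k k.2).hasDerivAt hV hx).2.1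
  set U := genericSet 𝕜 n (n / 2) ∩ ⋂ l, dom l with hU
  have hdomU : ∀ l, U ⊆ dom l := fun l x hx => Set.mem_iInter.1 hx.2 l
  have hDopen : IsOpen (⋂ l, dom l) := isOpen_iInter_of_finite hopen
  have hUopen : IsOpen U := (isOpen_genericSet n (n / 2)).inter hDopen
  have hLI : ∀ x ∈ U, LinearIndependent 𝕜 fun l => fderiv 𝕜 (F l) x := by
    intro x hx
    rw [Fintype.linearIndependent_iff]
    intro g hg
    set q : {k : ℕ // k ∈ Finset.Ioc k₀ (n / 2)} → 𝕜 := fun k =>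
      expo n γ k₀ k * p k (minor k₀ x) / minor k₀ x * minor k x with hq
    have h1 : ∑ k : {k : ℕ // k ∈ Finset.Ico 1 k₀}, g (Sum.inl k) • fderiv 𝕜 (minor k.val) x +
        (∑ k, g (Sum.inr k) * q k) • fderiv 𝕜 (minor k₀) x +
        ∑ k : {k : ℕ // k ∈ Finset.Ioc k₀ (n / 2)},
          (g (Sum.inr k) * p k (minor k₀ x)) • fderiv 𝕜 (minor k.val) x = 0 := by
      rw [Fintype.sum_sum_type] at hg
      rw [← hg, add_assoc, Finset.sum_smul (R := 𝕜) (M := (Idx n → 𝕜) →L[𝕜] 𝕜),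
        ← Finset.sum_add_distrib]
      congr 1
      · exact Finset.sum_congr rfl fun k _ => by rw [hFl]
      · refine Finset.sum_congr rfl fun k _ => ?_
        rw [hdF k x (hdomU _ hx), smul_add, smul_smul, smul_smul]
    rw [sum_extend (Finset.Ico 1 k₀) (fun k => g (Sum.inl k)) fun k => fderiv 𝕜 (minor k) x,
      sum_extend (Finset.Ioc k₀ (n / 2)) (fun k => g (Sum.inr k) * p k (minor k₀ x))
        fun k => fderiv 𝕜 (minor k) x] at h1
    have h2 := fderiv_minor_independent hx.1 (fun k =>
      if h : k ∈ Finset.Ico 1 k₀ then g (Sum.inl ⟨k, h⟩) else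
      if h : k ∈ Finset.Ioc k₀ (n / 2) then g (Sum.inr ⟨k, h⟩) * p k (minor k₀ x) else
        ∑ k, g (Sum.inr k) * q k) (by
      rw [sum_Icc_split hk₀, ← h1]
      congr 1
      · congr 1
        · exact Finset.sum_congr rfl fun k hk => by rw [dif_pos hk, dif_pos hk]
        · rw [dif_neg (by simp), dif_neg (by simp)]
      · refine Finset.sum_congr rfl fun k hk => ?_
        have hk' := Finset.mem_Ioc.1 hk
        rw [dif_neg (by rw [Finset.mem_Ico]; omega), dif_pos hk, dif_pos hk])
    rintro (k | k)
    · have hk := Finset.mem_Ico.1 k.2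
      have h3 := h2 k (by rw [Finset.mem_Icc]; omega)
      rwa [dif_pos k.2] at h3
    · have hk := Finset.mem_Ioc.1 k.2
      have h3 := h2 k (by rw [Finset.mem_Icc]; omega)
      rw [dif_neg (by rw [Finset.mem_Ico]; omega), dif_pos k.2] at h3
      exact (mul_eq_zero.1 h3).resolve_right (hpne k x (hdomU _ hx))
  refine ⟨hopen, hsm, hinv, U, hUopen, Set.inter_subset_right, ?_, hLI, ?_⟩
  · rw [hU, Set.inter_comm]
    exact (dense_genericSet (by omega)).open_subset_closure_inter hDopen
  intro W H hW hH hHinv x hx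
  refine exists_eventuallyEq_comp (hW.inter hUopen) (fun l => (hsm l).mono fun y hy => hdomU l hy.2)
    (hH.mono Set.inter_subset_left) ?_ hx (hLI x hx.2)
  intro y hy
  have hyg : y ∈ genericSet 𝕜 n (n / 2) := hy.2.1
  have hm0 : minor k₀ y ≠ 0 := hyg k₀ hk₀
  have hφ : ∀ i j : Fin n, i < j → fderiv 𝕜 H y (tvec γ y (Matrix.single i j 1)) = 0 :=
    fun i j hij => hHinv.fderiv_tvec_single hγ0 hW hH hy.1 hij
  have h0 : fderiv 𝕜 H y (Pi.single none 1) = 0 := by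
    have h1 := weight_mul_eq_zero (k := k₀) (by omega) (by omega) hm0
      (φ := (fderiv 𝕜 H y).toLinearMap) hφ
    exact (mul_eq_zero.1 h1).resolve_left hwne
  obtain ⟨c, hc⟩ := exists_eq_sum_fderiv_minor hγ0 hyg h0 hφ
  -- The torus direction gives the one relation between the coefficients.
  have hrel : c k₀ =
      ∑ k ∈ Finset.Ioc k₀ (n / 2), c k * (expo n γ k₀ k / minor k₀ y * minor k y) := by
    have h1 := hHinv.fderiv_tvec_gam hγ0 hW hH hy.1
    rw [hc, sum_apply, sum_Icc_split hk₀] at h1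
    simp only [smul_apply, smul_eq_mul] at h1
    rw [Finset.sum_eq_zero, zero_add, fderiv_minor_tvec_gam (by omega) hγ0] at h1
    · have h2 : ∑ k ∈ Finset.Ioc k₀ (n / 2), c k * fderiv 𝕜 (minor k) y (tvec γ y (Gam n γ)) =
          -(weight n γ k₀ * minor k₀ y *
            ∑ k ∈ Finset.Ioc k₀ (n / 2), c k * (expo n γ k₀ k / minor k₀ y * minor k y)) := by
        rw [Finset.mul_sum, ← Finset.sum_neg_distrib]
        refine Finset.sum_congr rfl fun k hk => ?_
        have hk' := Finset.mem_Ioc.1 hk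
        rw [fderiv_minor_tvec_gam (by omega) hγ0, hα k hk]
        field_simp
      rw [h2] at h1
      have h3 : weight n γ k₀ * minor k₀ y ≠ 0 := mul_ne_zero hwne hm0
      refine mul_left_cancel₀ h3 ?_
      linear_combination h1
    · intro k hk
      have hk' := Finset.mem_Ico.1 hk
      rw [fderiv_minor_tvec_gam (by omega) hγ0, hw0 k hk, zero_mul, mul_zero]
  refine ⟨Sum.elim (fun k => c k) fun k => c k / p k (minor k₀ y), ?_⟩
  rw [Fintype.sum_sum_type, hc, sum_Icc_split hk₀, hrel,
    Finset.sum_smul (R := 𝕜) (M := (Idx n → 𝕜) →L[𝕜] 𝕜), add_assoc,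
    ← Finset.sum_add_distrib]
  simp only [Sum.elim_inl, Sum.elim_inr, hFl]
  congr 1
  · exact (Finset.sum_coe_sort (Finset.Ico 1 k₀) fun k => c k • fderiv 𝕜 (minor k) y).symm
  · rw [← Finset.sum_coe_sort (Finset.Ioc k₀ (n / 2))]
    refine Finset.sum_congr rfl fun k _ => ?_
    have hpk := hpne k y (hdomU _ hy.2)
    rw [hdF k y (hdomU _ hy.2), smul_add, smul_smul, smul_smul, div_mul_cancel₀ _ hpk]
    congr 2
    field_simp

end TriangularLie

theorem theorem1 {𝕜 : Type*} [RCLike 𝕜] (n : ℕ) (γ : ℕ → 𝕜)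
    (hγ : ∃ i ∈ Finset.Icc 1 n, ∃ j ∈ Finset.Icc 1 n, γ i ≠ γ j) :
    ((∀ k ∈ Finset.Icc 1 (n / 2), γ k = γ (n - k + 1)) →
      TriangularLie.IsInvariantBasis n γ
        (ι := Option {k : ℕ // k ∈ Finset.Icc 1 (n / 2)})
        (fun l => match l with
          | some _ => Set.univ
          | none => {x | ∀ k ∈ Finset.Icc 1 (n / 2),
              γ k ≠ γ (k + 1) → TriangularLie.minor k x ≠ 0})
        (fun l => match l with
          | some k => fun x => TriangularLie.minor k.val x
          | none => fun x => TriangularLie.singInv γ x)) ∧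
    (∀ k₀ ∈ Finset.Icc 1 (n / 2), γ k₀ ≠ γ (n - k₀ + 1) →
      (∀ k ∈ Finset.Icc 1 (n / 2), k < k₀ → γ k = γ (n - k + 1)) →
      ∀ (V : Set 𝕜) (p : ℕ → 𝕜 → 𝕜), IsOpen V →
      (∀ k ∈ Finset.Ioc k₀ (n / 2),
        TriangularLie.IsPowerOn (TriangularLie.expo n γ k₀ k) V (p k)) →
      TriangularLie.IsInvariantBasis n γ
        (ι := {k : ℕ // k ∈ Finset.Ico 1 k₀} ⊕ {k : ℕ // k ∈ Finset.Ioc k₀ (n / 2)})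
        (fun l => match l with
          | Sum.inl _ => Set.univ
          | Sum.inr _ => {x | TriangularLie.minor k₀ x ∈ V})
        (fun l => match l with
          | Sum.inl k => fun x => TriangularLie.minor k.val x
          | Sum.inr k => fun x =>
              p k.val (TriangularLie.minor k₀ x) * TriangularLie.minor k.val x)) := by

  have hγ0 : ∃ i : Fin n, γ (i + 1) ≠ 0 := by
    obtain ⟨i, hi, j, hj, hij⟩ := hγ
    rw [Finset.mem_Icc] at hi hj
    by_cases h : γ i = 0
    · exact ⟨⟨j - 1, by omega⟩, fun h' => hij (by
        rw [h, ← h']; simp only [Nat.sub_add_cancel hj.1])⟩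
    · exact ⟨⟨i - 1, by omega⟩, by simpa only [Nat.sub_add_cancel hi.1] using h⟩
  exact ⟨fun hs => TriangularLie.isInvariantBasis_singular hγ0 hs (fun _ => rfl) rfl
      (fun _ => rfl) rfl,
    fun k₀ hk₀ hne hmin V p hV hp => TriangularLie.isInvariantBasis_regular hγ0 hk₀ hne hmin hV hp
      (fun _ => rfl) (fun _ => rfl) (fun _ => rfl) fun _ => rfl⟩
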